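/- **Setting.** Let $a=x_0<x_1<\dots<x_q<x_{q+1}=b$, let $d_0,\dots,d_q\ge 0$ be integers (degrees) and $k_1,\dots,k_q\ge 0$ integers with $k_i\le\min\{d_{i-1},d_i\}$ (continuities). The multi-degree spline space $\mathcal S$ consists of the functions on $[a,b]$ that on each $[x_i,x_{i+1}]$ agree with a polynomial $p_i$ of degree at most $d_i$, with $D^r p_{i-1}(x_i)=D^r p_i(x_i)$ for $0\le r\le k_i$, $1\le i\le q$. Put $K=d_0+1+\sum_{i=1}^q(d_i-k_i)$ and $m=\max_i d_i$. Let $(s_i)_{i=1}^K$ be the sequence $a$ ($d_0+1$ times), $x_1$ ($d_1-k_1$ times), …, $x_q$ ($d_q-k_q$ times), and $(t_i)_{i=1}^K$ the sequence $x_1$ ($d_0-k_1$ times), …, $x_q$ ($d_{q-1}-k_q$ times), $b$ ($d_q+1$ times). The MDB-spline basis of $\mathcal S$ is $N_i=N_{i,m}$, $i=1,\dots,K$, where $N_{i,n}$ ($0\le n\le m$, $m+1-n\le i\le K$) vanishes outside $[s_i,t_{i-m+n}]$ and, on each $[x_j,x_{j+1})\subset[s_i,t_{i-m+n}]$ (closed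 at $b$ for $j=q$), equals $1$ if $n=m-d_j$, equals $\int_{-\infty}^x\big(\delta_{i,n-1}N_{i,n-1}-\delta_{i+1,n-1}N_{i+1,n-1}\big)(u)\,du$ if $n>m-d_j$, and equals $0$ otherwise, with $\delta_{i,n}=\big(\int_{\mathbb R} N_{i,n}\big)^{-1}$. If $N_{i,n}$ is undefined or its support is trivial, $\int_{-\infty}^x\delta_{i,n}N_{i,n}$ is read as $0$ for $x<s_i$ and $1$ for $x\ge s_i$ (and as $0$ for $i>K$). The Greville abscissae of $\mathcal S$ are the coefficients $\xi_1,\dots,\xi_K$ with $\sum_{i=1}^K\xi_iN_i(x)=x$ for all $x$ in every $[x_j,x_{j+1}]$ with $d_j\ge1$. **Statement.** Let $1\le j\le q$ with $k_j\ge1$, and let $\widehat{\mathcal S}$ be the multi-degree spline space with the same breakpoints and degrees and the same continuities except that $k_j$ is replaced by $k_j-1$; let $\hat N_1,\dots,\hat N_{K+1}$ be its MDB-spline basis. Let $\ell\in\{1,\dots,K\}$ be the index with $s_\ell\le x_j<\min(s_{\ell+1},b)$, where $s_{K+1}:=b$. Then $\mathcal S\subset\widehat{\mathcal S}$, and there are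 reals $\alpha_1,\dots,\alpha_{K+1}$ with $$N_i=\alpha_i\hat N_i+(1-\alpha_{i+1})\hat N_{i+1}\quad\text{on }[a,b],\qquad i=1,\dots,K.$$ Any such coefficients satisfy $\alpha_i=1$ for $1\le i\le\ell-d_j$, $0<\alpha_i<1$ for $\ell-d_j+1\le i\le\ell-d_j+k_j$, and $\alpha_i=0$ for $\ell-d_j+k_j+1\le i\le K+1$. If moreover $\xi_i$ and $\hat\xi_i$ are the Greville abscissae of $\mathcal S$ and $\widehat{\mathcal S}$, then $$\xi_i\ne\xi_{i-1}\quad\text{and}\quad\alpha_i=\frac{\hat\xi_i-\xi_{i-1}}{\xi_i-\xi_{i-1}},\qquad i=\ell-d_j+1,\dots,\ell-d_j+k_j.$$ -/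

import Mathlib

noncomputable section

/-- The data of a multi-degree spline space: breakpoints `x 0 < x 1 < ⋯ < x (q + 1)`, the degree
`d i` on `[x i, x (i + 1)]` for `i = 0, …, q`, and the order of continuity `k i` at the interior
breakpoint `x i` for `i = 1, …, q`.  Values of `x`, `d`, `k` at other indices are never used. -/
structure MDSpline where
  q : ℕ
  x : ℕ → ℝ
  d : ℕ → ℕ
  k : ℕ → ℕ
  x_lt : ∀ i ≤ q, x i < x (i + 1)
  k_le : ∀ i ∈ Finset.Icc 1 q, k i ≤ min (d (i - 1)) (d i)

namespace MDSpline

variable (S : MDSpline)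

/-- Left end point of the interval of definition. -/
def a : ℝ := S.x 0

/-- Right end point of the interval of definition. -/
def b : ℝ := S.x (S.q + 1)

/-- The number of MDB-spline basis functions. -/
def K : ℕ := S.d 0 + 1 + ∑ i ∈ Finset.Icc 1 S.q, (S.d i - S.k i)

/-- The maximal degree. -/
def m : ℕ := (Finset.range (S.q + 1)).sup S.d

/-- The multi-degree spline space, a set of functions on `[a, b]`. -/
def space : Set (Set.Icc S.a S.b → ℝ) :=
  {f | ∃ p : ℕ → Polynomial ℝ,
    (∀ i ≤ S.q, (p i).natDegree ≤ S.d i) ∧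
    (∀ i ≤ S.q, ∀ y : Set.Icc S.a S.b, (y : ℝ) ∈ Set.Icc (S.x i) (S.x (i + 1)) →
      f y = (p i).eval (y : ℝ)) ∧
    (∀ i ∈ Finset.Icc 1 S.q, ∀ r ≤ S.k i,
      (Polynomial.derivative^[r] (p (i - 1))).eval (S.x i) =
        (Polynomial.derivative^[r] (p i)).eval (S.x i))}

/-- The left extended partition as a list: `a` repeated `d 0 + 1` times, then each `x i`
repeated `d i - k i` times, for `i = 1, …, q`. -/
def leftList : List ℝ :=
  List.replicate (S.d 0 + 1) S.a ++
    (List.range' 1 S.q).flatMap fun i => List.replicate (S.d i - S.k i) (S.x i)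

/-- The right extended partition as a list: each `x i` repeated `d (i - 1) - k i` times, for
`i = 1, …, q`, then `b` repeated `d q + 1` times. -/
def rightList : List ℝ :=
  ((List.range' 1 S.q).flatMap fun i => List.replicate (S.d (i - 1) - S.k i) (S.x i)) ++
    List.replicate (S.d S.q + 1) S.b

/-- `s i` for `1 ≤ i ≤ K` (numbering from 1), with the convention `s (K + 1) = b`. -/
def s (i : ℕ) : ℝ := S.leftList.getD (i - 1) S.b

/-- `t i` for `1 ≤ i ≤ K` (numbering from 1). -/
def t (i : ℕ) : ℝ := S.rightList.getD (i - 1) S.b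

/-- The `j`-th breakpoint interval `[x j, x (j + 1))`; the last one is closed, so that the basis
functions take at `b` the value of their last polynomial piece. -/
def piece (j : ℕ) : Set ℝ :=
  {y | S.x j ≤ y ∧ (y < S.x (j + 1) ∨ j = S.q ∧ y = S.b)}

/-- The `j`-th breakpoint interval lies in the support `[s i, t (i - m + n)]` of `N_{i,n}`,
where `m + 1 - n ≤ i ≤ K`. -/
def InSupport (n i j : ℕ) : Prop :=
  S.m + 1 ≤ i + n ∧ i ≤ S.K ∧ S.s i ≤ S.x j ∧ S.x (j + 1) ≤ S.t (i + n - S.m)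

/-- `N_{i,n}` is one of the functions of the recurrence: `m + 1 - n ≤ i ≤ K` and the support
`[s i, t (i - m + n)]` is nontrivial. -/
def IsDefined (n i : ℕ) : Prop :=
  S.m + 1 ≤ i + n ∧ i ≤ S.K ∧ S.s i < S.t (i + n - S.m)

open Classical in
/-- The normalized primitive `y ↦ ∫_{-∞}^y δ_{i,n} N_{i,n}(u) du`, where `F = N_{i,n}` and
`δ_{i,n}` is the reciprocal of the integral of `N_{i,n}`.  If `N_{i,n}` is undefined, this is by
convention `0` for `y < s i` and `1` for `y ≥ s i` (and `0` if `i > K`, when there is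
no `s i`). -/
def cumul (n i : ℕ) (F : ℝ → ℝ) (y : ℝ) : ℝ :=
  if S.IsDefined n i then (∫ u, F u)⁻¹ * ∫ u in Set.Iic y, F u
  else if i ≤ S.K ∧ S.s i ≤ y then 1 else 0

open Classical in
/-- The functions `N_{i,n}` of the integral recurrence (first argument `n`, second `i`).  On a
breakpoint interval `j` contained in the support, `N_{i,n}` is `1` if `n = m - d j`, is the
difference of the normalized primitives of `N_{i,n-1}` and `N_{i+1,n-1}` if `n > m - d j`, and
is `0` otherwise. -/
def N : ℕ → ℕ → ℝ → ℝ
  | 0, i, y => ∑ j ∈ Finset.range (S.q + 1),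
      if y ∈ S.piece j ∧ S.InSupport 0 i j ∧ S.d j = S.m then 1 else 0
  | n + 1, i, y => ∑ j ∈ Finset.range (S.q + 1),
      if y ∈ S.piece j ∧ S.InSupport (n + 1) i j then
        (if n + 1 + S.d j = S.m then 1
          else if S.m < n + 1 + S.d j then
            S.cumul n i (N n i) y - S.cumul n (i + 1) (N n (i + 1)) y
          else 0)
      else 0

/-- The MDB-spline basis function `N_{i,m}`, for `1 ≤ i ≤ K`. -/
def basis (i : ℕ) : ℝ → ℝ := S.N S.m i

/-- `ξ 1, …, ξ K` are the Greville abscissae: the coefficients of the identity function in the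
MDB-spline basis (on all intervals of degree at least one). -/
def IsGreville (ξ : ℕ → ℝ) : Prop :=
  ∀ j ≤ S.q, 1 ≤ S.d j → ∀ y ∈ Set.Icc (S.x j) (S.x (j + 1)),
    ∑ i ∈ Finset.Icc 1 S.K, ξ i * S.basis i y = y

/-- Same breakpoints and degrees, with the continuity at `x j` lowered by one (used only when
`1 ≤ k j`). -/
def lower (j : ℕ) : MDSpline where
  q := S.q
  x := S.x
  d := S.d
  k := Function.update S.k j (S.k j - 1)
  x_lt := S.x_lt
  k_le := by
    intro i hi
    have h := S.k_le i hi
    by_cases hij : i = j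
    · subst hij
      rw [Function.update_self]
      exact (Nat.sub_le _ _).trans h
    · rw [Function.update_of_ne hij]
      exact h

/-- `α 1, …, α (K + 1)` are coefficients of reverse knot insertion, that is, they express the
MDB-spline basis of `S` through that of `S.lower j`. -/
def IsRKI (j : ℕ) (α : ℕ → ℝ) : Prop :=
  ∀ i ∈ Finset.Icc 1 S.K, ∀ y ∈ Set.Icc S.a S.b,
    S.basis i y = α i * (S.lower j).basis i y + (1 - α (i + 1)) * (S.lower j).basis (i + 1) y

end MDSpline

end

noncomputable section

open MeasureTheory

namespace MDSpline

section

/-! ### Counting the extended partitions -/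

/-! The argument runs on the normalized primitives C_{i,n} = `cumulBasis n i` rather than on the
functions N_{i,n}. On pieces with n + d_p ≥ m one has N_{i,n} = C_{i,n} - C_{i+1,n}, without case
distinctions (`N_eq`). Lowering the continuity at x_j adds one copy of x_j to both extended
partitions, so indices stay put left of x_j and shift by one right of it. By induction on n, C_{i,n}
is a convex combination of Ĉ_{i,n} and Ĉ_{i+1,n} (`IsLevelRKI`): differencing in i gives the
two-term relation for N_{i,n}, and integrating and normalizing that relation gives level n + 1. The
weights strictly between 0 and 1 at level n + 1 belong to the N_{i,n} whose support crosses x_j;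
their number grows from none at n = 0 to k_j at n = m.

Normalizing needs positive integrals (`PosAt`). The two-term relation carries positivity from the
lowered space back to the given one, so induction on the sum of the continuities reduces to the case
where all of them vanish. There every function below the top level is a Bernstein polynomial on a
single interval (`cumulBasis_eq_bernsteinTail`).

Uniqueness of the α_i follows from linear independence on each breakpoint interval
(`coeff_eq_of_sum_eq_const`): differentiation lowers the level and turns coefficients into weighted
differences. The same differentiation, applied to ∑ ξ_i N_i = x, shows ξ_i ≠ ξ_{i-1}. Inserting the
two-term relation into that sum and comparing coefficients on [x_j, x_{j+1}] gives ξ̂_i = α_i ξ_i +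
(1 - α_i) ξ_{i-1}, which is solved for α_i. -/

theorem getD_le_of_append {P Q : List ℝ} {u c : ℝ} (hP : ∀ e ∈ P, e ≤ u) {i : ℕ}
    (hi : i < P.length) : (P ++ Q).getD i c ≤ u := by
  rw [List.getD_append _ _ _ _ hi, List.getD_eq_getElem _ _ hi]
  exact hP _ (List.getElem_mem hi)

theorem le_getD_of_append {P Q : List ℝ} {v c : ℝ} (hQ : ∀ e ∈ Q, v ≤ e) (hc : v ≤ c) {i : ℕ}
    (hi : P.length ≤ i) : v ≤ (P ++ Q).getD i c := by
  rw [List.getD_append_right _ _ _ _ hi]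
  by_cases h : i - P.length < Q.length
  · rw [List.getD_eq_getElem _ _ h]
    exact hQ _ (List.getElem_mem h)
  · rw [List.getD_eq_default _ _ (not_lt.1 h)]
    exact hc

theorem length_flatMap_replicate (c : ℕ → ℕ) (x : ℕ → ℝ) (p : ℕ) :
    ((List.range' 1 p).flatMap fun i => List.replicate (c i) (x i)).length =
      ∑ i ∈ Finset.Icc 1 p, c i := by
  induction p with
  | zero => simp
  | succ p ih =>
    rw [List.range'_concat, List.flatMap_append, List.length_append, ih,
      Finset.sum_Icc_succ_top (by omega)]
    simp [add_comm]

theorem flatMap_range'_split (f : ℕ → List ℝ) {p q : ℕ} (h : p ≤ q) :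
    (List.range' 1 q).flatMap f =
      (List.range' 1 p).flatMap f ++ (List.range' (p + 1) (q - p)).flatMap f := by
  rw [← List.flatMap_append, add_comm p 1]
  congr 1
  have := List.range'_append (s := 1) (m := p) (n := q - p) (step := 1)
  rw [one_mul, Nat.add_sub_cancel' h] at this
  exact this.symm

variable (S : MDSpline)

theorem x_mono {p r : ℕ} (h : p ≤ r) (hr : r ≤ S.q + 1) : S.x p ≤ S.x r := by
  induction r, h using Nat.le_induction with
  | base => exact le_rfl
  | succ r _ ih => exact (ih (by omega)).trans (S.x_lt r (by omega)).le

/-- The number of `s i` that are at most `x p`. -/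
def leftCount (p : ℕ) : ℕ := S.d 0 + 1 + ∑ i ∈ Finset.Icc 1 p, (S.d i - S.k i)

/-- The number of `t i` that are at most `x p`. -/
def rightCount (p : ℕ) : ℕ := ∑ i ∈ Finset.Icc 1 p, (S.d (i - 1) - S.k i)

theorem leftCount_q : S.leftCount S.q = S.K := rfl

theorem rightCount_zero : S.rightCount 0 = 0 := by simp [rightCount]

theorem leftCount_succ (p : ℕ) :
    S.leftCount (p + 1) = S.leftCount p + (S.d (p + 1) - S.k (p + 1)) := by
  simp [leftCount, Finset.sum_Icc_succ_top, add_assoc]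

theorem rightCount_succ (p : ℕ) :
    S.rightCount (p + 1) = S.rightCount p + (S.d p - S.k (p + 1)) := by
  simp [rightCount, Finset.sum_Icc_succ_top]

theorem leftCount_mono : Monotone S.leftCount :=
  monotone_nat_of_le_succ fun p => by rw [leftCount_succ]; omega

theorem rightCount_mono : Monotone S.rightCount :=
  monotone_nat_of_le_succ fun p => by rw [rightCount_succ]; omega

theorem k_le_succ {p : ℕ} (hp : p < S.q) : S.k (p + 1) ≤ S.d p ∧ S.k (p + 1) ≤ S.d (p + 1) := by
  have := S.k_le (p + 1) (Finset.mem_Icc.2 ⟨by omega, by omega⟩)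
  simpa using this

/-- This is the dimension count on one interval: the d_p + 1 indices in (`rightCount p`, `leftCount
p`] are those of the basis functions living on piece p. -/
theorem leftCount_eq {p : ℕ} (hp : p ≤ S.q) : S.leftCount p = S.rightCount p + S.d p + 1 := by
  induction p with
  | zero => simp [leftCount, rightCount]
  | succ p ih =>
    have := S.k_le_succ hp
    rw [leftCount_succ, rightCount_succ, ih (by omega)]
    omega

/-- At the top level, exactly k_{p+1} + 1 functions live on both sides of x_{p+1}. -/
theorem rightCount_succ_add {p : ℕ} (hp : p < S.q) :
    S.rightCount (p + 1) + S.k (p + 1) + 1 = S.leftCount p := by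
  have := S.k_le_succ hp
  rw [rightCount_succ, S.leftCount_eq hp.le]
  omega

theorem leftCount_le_K {p : ℕ} (hp : p ≤ S.q) : S.leftCount p ≤ S.K := by
  rw [← leftCount_q]; exact S.leftCount_mono hp

theorem d_le_m {p : ℕ} (hp : p ≤ S.q) : S.d p ≤ S.m :=
  Finset.le_sup (f := S.d) (Finset.mem_range.2 (by omega))

theorem leftList_split {p : ℕ} (hp : p ≤ S.q) :
    ∃ P Q : List ℝ, S.leftList = P ++ Q ∧ P.length = S.leftCount p ∧
      (∀ e ∈ P, e ≤ S.x p) ∧ ∀ e ∈ Q, S.x (p + 1) ≤ e := by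
  rw [leftList, flatMap_range'_split _ hp, ← List.append_assoc]
  refine ⟨_, _, rfl, ?_, ?_, ?_⟩
  · rw [List.length_append, length_flatMap_replicate, List.length_replicate, leftCount]
  · intro e he
    simp only [List.mem_append, List.mem_replicate, List.mem_flatMap, List.mem_range'_1] at he
    rcases he with ⟨-, rfl⟩ | ⟨i, hi, -, rfl⟩
    · exact S.x_mono (Nat.zero_le _) (by omega)
    · exact S.x_mono (by omega) (by omega)
  · intro e he
    simp only [List.mem_replicate, List.mem_flatMap, List.mem_range'_1] at he
    obtain ⟨i, hi, -, rfl⟩ := he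
    exact S.x_mono (by omega) (by omega)

theorem rightList_split {p : ℕ} (hp : p ≤ S.q) :
    ∃ P Q : List ℝ, S.rightList = P ++ Q ∧ P.length = S.rightCount p ∧
      (∀ e ∈ P, e ≤ S.x p) ∧ ∀ e ∈ Q, S.x (p + 1) ≤ e := by
  rw [rightList, flatMap_range'_split _ hp, List.append_assoc]
  refine ⟨_, _, rfl, ?_, ?_, ?_⟩
  · rw [length_flatMap_replicate, rightCount]
  · intro e he
    simp only [List.mem_replicate, List.mem_flatMap, List.mem_range'_1] at he
    obtain ⟨i, hi, -, rfl⟩ := he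
    exact S.x_mono (by omega) (by omega)
  · intro e he
    simp only [List.mem_append, List.mem_replicate, List.mem_flatMap, List.mem_range'_1] at he
    rcases he with ⟨i, hi, -, rfl⟩ | ⟨-, rfl⟩
    · exact S.x_mono (by omega) (by omega)
    · exact S.x_mono (by omega) (by omega)

theorem s_le {p i : ℕ} (hp : p ≤ S.q) (hi : i ≤ S.leftCount p) : S.s i ≤ S.x p := by
  obtain ⟨P, Q, h, hl, hP, -⟩ := S.leftList_split hp
  have : 0 < S.leftCount p := by rw [leftCount]; omega
  rw [s, h]
  exact getD_le_of_append hP (by omega)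

theorem le_s {p i : ℕ} (hp : p ≤ S.q) (hi : S.leftCount p < i) : S.x (p + 1) ≤ S.s i := by
  obtain ⟨P, Q, h, hl, -, hQ⟩ := S.leftList_split hp
  rw [s, h]
  exact le_getD_of_append hQ (S.x_mono (by omega) le_rfl) (by omega)

theorem t_le {p i : ℕ} (hp : p ≤ S.q) (hi0 : 1 ≤ i) (hi : i ≤ S.rightCount p) :
    S.t i ≤ S.x p := by
  obtain ⟨P, Q, h, hl, hP, -⟩ := S.rightList_split hp
  rw [t, h]
  exact getD_le_of_append hP (by omega)

theorem le_t {p i : ℕ} (hp : p ≤ S.q) (hi : S.rightCount p < i) : S.x (p + 1) ≤ S.t i := by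
  obtain ⟨P, Q, h, hl, -, hQ⟩ := S.rightList_split hp
  rw [t, h]
  exact le_getD_of_append hQ (S.x_mono (by omega) le_rfl) (by omega)

theorem s_le_iff {p i : ℕ} (hp : p ≤ S.q) : S.s i ≤ S.x p ↔ i ≤ S.leftCount p := by
  refine ⟨fun h => ?_, S.s_le hp⟩
  by_contra! hc
  exact absurd ((S.x_lt p hp).trans_le (S.le_s hp hc)) (not_lt.2 h)

theorem le_t_iff {p i : ℕ} (hp : p ≤ S.q) (hi : 1 ≤ i) :
    S.x (p + 1) ≤ S.t i ↔ S.rightCount p < i := by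
  refine ⟨fun h => ?_, S.le_t hp⟩
  by_contra! hc
  exact absurd ((S.t_le hp hi hc).trans_lt (S.x_lt p hp)) (not_lt.2 h)

/-- Combinatorial form of `InSupport`. -/
def Active (n i p : ℕ) : Prop := S.rightCount p + S.m < i + n ∧ i ≤ S.leftCount p

theorem inSupport_iff {n i p : ℕ} (hp : p ≤ S.q) : S.InSupport n i p ↔ S.Active n i p := by
  have hK := S.leftCount_le_K hp
  unfold InSupport Active
  rw [S.s_le_iff hp]
  constructor
  · rintro ⟨h1, -, h3, h4⟩
    rw [S.le_t_iff hp (by omega)] at h4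
    exact ⟨by omega, h3⟩
  · rintro ⟨h1, h2⟩
    refine ⟨by omega, by omega, h2, ?_⟩
    rw [S.le_t_iff hp (by omega)]
    omega

theorem isDefined_iff {n i : ℕ} : S.IsDefined n i ↔ ∃ p ≤ S.q, S.Active n i p := by
  classical
  constructor
  · rintro ⟨h1, h2, h3⟩
    -- The least such p is the piece starting at s_i; if N_{i,n} were not active there, its right
    -- end would be at most s_i.
    have hex : ∃ p, i ≤ S.leftCount p := ⟨S.q, h2⟩
    have hle : Nat.find hex ≤ S.q := Nat.find_min' hex h2
    refine ⟨Nat.find hex, hle, ?_, Nat.find_spec hex⟩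
    rcases hp : Nat.find hex with _ | p
    · rw [rightCount_zero]; omega
    · by_contra! hc
      have h4 : S.leftCount p < i := not_le.1 (Nat.find_min hex (by omega))
      have h5 := S.le_s (by omega) h4
      have h6 := S.t_le (p := p + 1) (i := i + n - S.m) (by omega) (by omega) (by omega)
      linarith
  · rintro ⟨p, hp, hA⟩
    obtain ⟨h1, h2, h3, h4⟩ := (S.inSupport_iff hp).2 hA
    exact ⟨h1, h2, h3.trans_lt ((S.x_lt p hp).trans_le h4)⟩

variable {S}

/-- The active window on piece p has n + d_p + 1 - m indices, so the "equals 0 otherwise" branch of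
the recurrence never occurs inside a support. -/
theorem Active.le {n i p : ℕ} (h : S.Active n i p) (hp : p ≤ S.q) : S.m ≤ n + S.d p := by
  have := S.leftCount_eq hp
  have := h.1
  have := h.2
  omega

/-! ### Breakpoint intervals -/

theorem piece_unique {p r : ℕ} (hp : p ≤ S.q) (hr : r ≤ S.q) {y : ℝ} (h : y ∈ S.piece p)
    (h' : y ∈ S.piece r) : p = r := by
  have key : ∀ {p r : ℕ}, p ≤ S.q → r ≤ S.q → y ∈ S.piece p → y ∈ S.piece r → ¬ p < r := by
    intro p r _ hr h h' hlt
    have := S.x_mono (p := p + 1) (r := r) hlt (by omega)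
    rcases h.2 with h2 | ⟨h2, -⟩
    · linarith [h'.1]
    · omega
  rcases lt_trichotomy p r with h1 | h1 | h1
  · exact absurd h1 (key hp hr h h')
  · exact h1
  · exact absurd h1 (key hr hp h' h)

theorem piece_subset_Icc {p : ℕ} (hp : p ≤ S.q) : S.piece p ⊆ Set.Icc (S.x p) (S.x (p + 1)) := by
  rintro y ⟨h1, h2 | ⟨rfl, h2⟩⟩
  · exact ⟨h1, h2.le⟩
  · exact ⟨h1, h2.le⟩

theorem Ioo_subset_piece (p : ℕ) : Set.Ioo (S.x p) (S.x (p + 1)) ⊆ S.piece p :=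
  fun _ h => ⟨h.1.le, Or.inl h.2⟩

theorem piece_subset {p : ℕ} (hp : p ≤ S.q) : S.piece p ⊆ Set.Icc S.a S.b := fun _ hy =>
  ⟨(S.x_mono (Nat.zero_le _) (by omega)).trans (piece_subset_Icc hp hy).1,
    (piece_subset_Icc hp hy).2.trans (S.x_mono (by omega) le_rfl)⟩

theorem mem_piece_of_le {p : ℕ} {y z : ℝ} (hy : y ∈ S.piece p) (hz : S.x p ≤ z) (h : z ≤ y) :
    z ∈ S.piece p := by
  refine ⟨hz, ?_⟩
  rcases hy.2 with h1 | ⟨h1, h2⟩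
  · exact Or.inl (h.trans_lt h1)
  · rcases h.eq_or_lt with h3 | h3
    · exact Or.inr ⟨h1, h3.trans h2⟩
    · left; rw [h1]; exact h3.trans_eq h2

theorem le_of_mem_piece_of_le {p r : ℕ} (hr : r ≤ S.q) {y z : ℝ}
    (hy : y ∈ S.piece p) (hz : z ∈ S.piece r) (h : z ≤ y) : r ≤ p := by
  by_contra! hc
  have := S.x_mono (p := p + 1) (r := r) hc (by omega)
  rcases hy.2 with h1 | ⟨h1, h2⟩
  · linarith [hz.1]
  · omega

/-! ### The recurrence in combinatorial form -/

/-- `cumulBasis (n + 1) i` is the normalized primitive of `N_{i,n}`; `cumulBasis 0 i` is the step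
function at `s i`. -/
def cumulBasis (S : MDSpline) (n i : ℕ) (y : ℝ) : ℝ :=
  match n with
  | 0 => open Classical in if i ≤ S.K ∧ S.s i ≤ y then 1 else 0
  | n + 1 => S.cumul n i (S.N n i) y

/-- Nonnegativity of all `N_{i,n}` and positivity of the integrals of those that are defined. -/
def PosAt (S : MDSpline) (n : ℕ) : Prop :=
  ∀ i, (∀ y, 0 ≤ S.N n i y) ∧ (S.IsDefined n i → 0 < ∫ u, S.N n i u)

theorem step_iff {p i : ℕ} (hp : p ≤ S.q) {y : ℝ} (hy : y ∈ S.piece p) :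
    (i ≤ S.K ∧ S.s i ≤ y) ↔ i ≤ S.leftCount p := by
  constructor
  · rintro ⟨h1, h2⟩
    by_contra! hc
    have := S.le_s hp hc
    rcases hy.2 with h3 | ⟨rfl, -⟩
    · linarith
    · rw [leftCount_q] at hc; omega
  · intro h
    exact ⟨h.trans (S.leftCount_le_K hp), (S.s_le hp h).trans hy.1⟩

theorem sum_piece {p : ℕ} (hp : p ≤ S.q) {y : ℝ} (hy : y ∈ S.piece p) (Q : ℕ → Prop)
    (g : ℕ → ℝ) [∀ r, Decidable (y ∈ S.piece r ∧ Q r)] [Decidable (Q p)] :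
    (∑ r ∈ Finset.range (S.q + 1), if y ∈ S.piece r ∧ Q r then g r else 0) =
      if Q p then g p else 0 := by
  rw [Finset.sum_eq_single p]
  · simp [hy]
  · intro r hr hne
    rw [if_neg]
    rintro ⟨h, -⟩
    exact hne (piece_unique (by simpa [Nat.lt_succ_iff] using hr) hp h hy)
  · intro h
    exact absurd (Finset.mem_range.2 (by omega)) h

open Classical in
theorem N_zero_apply {p i : ℕ} (hp : p ≤ S.q) {y : ℝ} (hy : y ∈ S.piece p) :
    S.N 0 i y = if S.Active 0 i p then 1 else 0 := by
  rw [N, sum_piece hp hy (fun r => S.InSupport 0 i r ∧ S.d r = S.m) (fun _ => 1)]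
  rw [S.inSupport_iff hp]
  refine if_congr ⟨And.left, fun h => ⟨h, ?_⟩⟩ rfl rfl
  have := h.le hp
  have := S.d_le_m hp
  omega

open Classical in
theorem N_succ_apply {n p i : ℕ} (hp : p ≤ S.q) {y : ℝ} (hy : y ∈ S.piece p) :
    S.N (n + 1) i y = if S.Active (n + 1) i p then
      (if n + 1 + S.d p = S.m then 1
        else S.cumulBasis (n + 1) i y - S.cumulBasis (n + 1) (i + 1) y) else 0 := by
  rw [N, sum_piece hp hy (fun r => S.InSupport (n + 1) i r) (fun r =>
    (if n + 1 + S.d r = S.m then 1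
          else if S.m < n + 1 + S.d r then
            S.cumul n i (S.N n i) y - S.cumul n (i + 1) (S.N n (i + 1)) y
          else 0))]
  rw [S.inSupport_iff hp]
  by_cases h : S.Active (n + 1) i p
  · rw [if_pos h, if_pos h]
    by_cases h1 : n + 1 + S.d p = S.m
    · rw [if_pos h1, if_pos h1]
    · have := h.le hp
      rw [if_neg h1, if_neg h1, if_pos (by omega)]
      rfl
  · rw [if_neg h, if_neg h]

theorem N_eq_zero {n p i : ℕ} (hp : p ≤ S.q) {y : ℝ} (hy : y ∈ S.piece p)
    (h : ¬ S.Active n i p) : S.N n i y = 0 := by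
  classical
  cases n with
  | zero => rw [N_zero_apply hp hy, if_neg h]
  | succ n => rw [N_succ_apply hp hy, if_neg h]

theorem N_outside {n i : ℕ} {y : ℝ} (hy : ∀ p ≤ S.q, y ∉ S.piece p) : S.N n i y = 0 := by
  cases n with
  | zero =>
    rw [N]
    exact Finset.sum_eq_zero fun r hr =>
      if_neg fun h => hy r (by simpa [Nat.lt_succ_iff] using hr) h.1
  | succ n =>
    rw [N]
    exact Finset.sum_eq_zero fun r hr =>
      if_neg fun h => hy r (by simpa [Nat.lt_succ_iff] using hr) h.1

theorem cumulBasis_eq_zero {n p i : ℕ} (hp : p ≤ S.q) {y : ℝ} (hy : y ∈ S.piece p)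
    (hi : S.leftCount p < i) : S.cumulBasis n i y = 0 := by
  have hst : ¬ (i ≤ S.K ∧ S.s i ≤ y) := by rw [step_iff hp hy]; omega
  cases n with
  | zero => rw [cumulBasis, if_neg hst]
  | succ n =>
    rw [cumulBasis, cumul]
    by_cases h : S.IsDefined n i
    · rw [if_pos h, setIntegral_eq_zero_of_forall_eq_zero, mul_zero]
      intro z hz
      by_cases hz' : ∃ r ≤ S.q, z ∈ S.piece r
      · obtain ⟨r, hr, hzr⟩ := hz'
        refine N_eq_zero hr hzr fun hA => ?_
        have := S.leftCount_mono (le_of_mem_piece_of_le hr hy hzr hz)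
        have := hA.2
        omega
      · push Not at hz'
        exact N_outside hz'
    · rw [if_neg h, if_neg hst]

theorem cumulBasis_undefined {n p i : ℕ} (hp : p ≤ S.q) {y : ℝ} (hy : y ∈ S.piece p)
    (h : ¬ S.IsDefined n i) :
    S.cumulBasis (n + 1) i y = if i ≤ S.leftCount p then 1 else 0 := by
  rw [cumulBasis, cumul, if_neg h]
  exact if_congr (step_iff hp hy) rfl rfl

/-- Beyond the support the whole integral has been collected; positivity makes its reciprocal a true
inverse. -/
theorem cumulBasis_eq_one {n p i : ℕ} (hpos : ∀ n' < n, S.PosAt n') (hp : p ≤ S.q) {y : ℝ}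
    (hy : y ∈ S.piece p) (hi : i ≤ S.leftCount p) (hi' : i + n ≤ S.rightCount p + S.m + 1) :
    S.cumulBasis n i y = 1 := by
  have hst : i ≤ S.K ∧ S.s i ≤ y := (step_iff hp hy).2 hi
  cases n with
  | zero => rw [cumulBasis, if_pos hst]
  | succ n =>
    rw [cumulBasis, cumul]
    by_cases h : S.IsDefined n i
    · rw [if_pos h, setIntegral_eq_integral_of_forall_compl_eq_zero]
      · exact inv_mul_cancel₀ ((hpos n (by omega) i).2 h).ne'
      intro z hz
      by_cases hz' : ∃ r ≤ S.q, z ∈ S.piece r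
      · obtain ⟨r, hr, hzr⟩ := hz'
        refine N_eq_zero hr hzr fun hA => ?_
        have hz2 : y ≤ z := (not_le.1 hz).le
        have := S.rightCount_mono (le_of_mem_piece_of_le hp hzr hy hz2)
        have := hA.1
        omega
      · push Not at hz'
        exact N_outside hz'
    · rw [if_neg h, if_pos hst]

/-- Outside the active window the two primitives are both 0 or both 1. When n = m - d_p the window
has a single index, and the difference there is 1 - 0, which matches the constant branch of the
recurrence. -/
theorem N_eq {n p i : ℕ} (hpos : ∀ n' < n, S.PosAt n') (hp : p ≤ S.q) {y : ℝ}
    (hy : y ∈ S.piece p) :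
    S.N n i y = if S.m ≤ n + S.d p then S.cumulBasis n i y - S.cumulBasis n (i + 1) y else 0 := by
  have hc := S.leftCount_eq hp
  have hdm := S.d_le_m hp
  by_cases hd : S.m ≤ n + S.d p
  · rw [if_pos hd]
    by_cases hA : S.Active n i p
    · obtain ⟨h1, h2⟩ := id hA
      by_cases he : n + S.d p = S.m
      · rw [cumulBasis_eq_one hpos hp hy h2 (by omega), cumulBasis_eq_zero hp hy (by omega)]
        cases n with
        | zero => rw [N_zero_apply hp hy, if_pos hA, sub_zero]
        | succ n => rw [N_succ_apply hp hy, if_pos hA, if_pos he, sub_zero]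
      · cases n with
        | zero => omega
        | succ n => rw [N_succ_apply hp hy, if_pos hA, if_neg he]
    · rw [N_eq_zero hp hy hA]
      by_cases hi : i ≤ S.leftCount p
      · have h3 : i + n ≤ S.rightCount p + S.m := by
          by_contra! h4
          exact hA ⟨h4, hi⟩
        rw [cumulBasis_eq_one hpos hp hy hi (by omega),
          cumulBasis_eq_one hpos hp hy (by omega) (by omega), sub_self]
      · rw [cumulBasis_eq_zero hp hy (by omega), cumulBasis_eq_zero hp hy (by omega), sub_self]
  · rw [if_neg hd]
    exact N_eq_zero hp hy fun hA => hd (hA.le hp)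

end

section

variable {S : MDSpline}

/-! ### Regularity on the breakpoint intervals -/

/-- The normalization factor of `N_{i,n}`, read as `0` if `N_{i,n}` is undefined. -/
def weight (S : MDSpline) (n i : ℕ) : ℝ :=
  open Classical in if S.IsDefined n i then (∫ u, S.N n i u)⁻¹ else 0

theorem measurableSet_piece (p : ℕ) : MeasurableSet (S.piece p) :=
  measurableSet_Ici.inter (measurableSet_Iio.union
    ((MeasurableSet.const _).inter (measurableSet_singleton _)))

theorem integrable_of_piecewise {f : ℝ → ℝ}
    (h : ∀ p ≤ S.q, ∃ g : ℝ → ℝ, Continuous g ∧ ∀ y ∈ S.piece p, f y = g y)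
    (h0 : ∀ y, (∀ p ≤ S.q, y ∉ S.piece p) → f y = 0) : Integrable f := by
  classical
  have hf : f = ∑ p ∈ Finset.range (S.q + 1), (S.piece p).indicator f := by
    funext y
    rw [Finset.sum_apply]
    by_cases hy : ∃ p ≤ S.q, y ∈ S.piece p
    · obtain ⟨p, hp, hy⟩ := hy
      rw [Finset.sum_eq_single p]
      · rw [Set.indicator_of_mem hy]
      · intro r hr hne
        refine Set.indicator_of_notMem (fun h => hne ?_) _
        exact piece_unique (by simpa [Nat.lt_succ_iff] using hr) hp h hy
      · intro h
        exact absurd (Finset.mem_range.2 (by omega)) h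
    · push Not at hy
      rw [h0 y hy]
      exact (Finset.sum_eq_zero fun r hr =>
        Set.indicator_of_notMem (hy r (by simpa [Nat.lt_succ_iff] using hr)) _).symm
  rw [hf]
  refine integrable_finsetSum' _ fun p hp => ?_
  have hp' : p ≤ S.q := by simpa [Nat.lt_succ_iff] using hp
  obtain ⟨g, hg, hfg⟩ := h p hp'
  rw [integrable_indicator_iff (measurableSet_piece p)]
  exact ((hg.integrableOn_Icc).mono_set (piece_subset_Icc hp')).congr_fun
    (fun y hy => (hfg y hy).symm) (measurableSet_piece p)

theorem left_mem_piece {p : ℕ} (hp : p ≤ S.q) : S.x p ∈ S.piece p :=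
  ⟨le_rfl, Or.inl (S.x_lt p hp)⟩

/-- Undefined functions fit in with weight 0: their step sits at a breakpoint, so it is constant on
each piece. -/
theorem cumulBasis_succ_eq {n p i : ℕ} (hp : p ≤ S.q) (hint : Integrable (S.N n i)) {y : ℝ}
    (hy : y ∈ S.piece p) :
    S.cumulBasis (n + 1) i y =
      S.cumulBasis (n + 1) i (S.x p) + S.weight n i * ∫ u in S.x p..y, S.N n i u := by
  classical
  by_cases h : S.IsDefined n i
  · rw [← intervalIntegral.integral_Iic_sub_Iic hint.integrableOn hint.integrableOn]
    simp only [cumulBasis, cumul, if_pos h, weight]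
    ring
  · rw [weight, if_neg h, zero_mul, add_zero, cumulBasis_undefined hp hy h,
      cumulBasis_undefined hp (left_mem_piece hp) h]

theorem exists_hasDerivAt_cumulBasis {n p i : ℕ} (hp : p ≤ S.q) (hint : Integrable (S.N n i))
    {g : ℝ → ℝ} (hg : Continuous g) (h : ∀ y ∈ S.piece p, S.N n i y = g y) :
    ∃ G : ℝ → ℝ, (∀ y, HasDerivAt G (S.weight n i * g y) y) ∧
      ∀ y ∈ S.piece p, S.cumulBasis (n + 1) i y = G y := by
  refine ⟨fun y => S.cumulBasis (n + 1) i (S.x p) + S.weight n i * ∫ u in S.x p..y, g u,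
    fun y => ?_, fun y hy => ?_⟩
  · exact ((hg.integral_hasStrictDerivAt (S.x p) y).hasDerivAt.const_mul _).const_add _
  · rw [cumulBasis_succ_eq hp hint hy]
    congr 2
    refine intervalIntegral.integral_congr fun z hz => h z ?_
    rw [Set.uIcc_of_le hy.1] at hz
    exact mem_piece_of_le hy hz.1 hz.2

/-- Integrability of level n is needed to control the primitives that form level n + 1, so piecewise
continuity is carried through the induction. -/
theorem exists_continuous_N (n : ℕ) :
    ∀ i, ∀ p ≤ S.q, ∃ g : ℝ → ℝ, Continuous g ∧ ∀ y ∈ S.piece p, S.N n i y = g y := by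
  classical
  induction n with
  | zero =>
    exact fun i p hp => ⟨fun _ => if S.Active 0 i p then 1 else 0, continuous_const,
      fun y hy => N_zero_apply hp hy⟩
  | succ n ih =>
    intro i p hp
    have key : ∀ i, ∃ G : ℝ → ℝ, Continuous G ∧
        ∀ y ∈ S.piece p, S.cumulBasis (n + 1) i y = G y := by
      intro i
      obtain ⟨g, hg, hN⟩ := ih i p hp
      obtain ⟨G, hG, hD⟩ := exists_hasDerivAt_cumulBasis hp
        (integrable_of_piecewise (ih i) fun y hy => N_outside hy) hg hN
      exact ⟨G, continuous_iff_continuousAt.2 fun y => (hG y).continuousAt, hD⟩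
    obtain ⟨G, hG, h⟩ := key i
    obtain ⟨G', hG', h'⟩ := key (i + 1)
    by_cases hA : S.Active (n + 1) i p
    · by_cases hd : n + 1 + S.d p = S.m
      · refine ⟨fun _ => 1, continuous_const, fun y hy => ?_⟩
        rw [N_succ_apply hp hy, if_pos hA, if_pos hd]
      · refine ⟨fun y => G y - G' y, hG.sub hG', fun y hy => ?_⟩
        rw [N_succ_apply hp hy, if_pos hA, if_neg hd, h y hy, h' y hy]
    · exact ⟨fun _ => 0, continuous_const, fun y hy => N_eq_zero hp hy hA⟩

theorem integrable_N (n i : ℕ) : Integrable (S.N n i) :=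
  integrable_of_piecewise (exists_continuous_N n i) fun _ hy => N_outside hy

theorem hasDerivAt_cumulBasis {n p i : ℕ} (hp : p ≤ S.q) {y : ℝ}
    (hy : y ∈ Set.Ioo (S.x p) (S.x (p + 1))) :
    HasDerivAt (S.cumulBasis (n + 1) i) (S.weight n i * S.N n i y) y := by
  obtain ⟨g, hg, hN⟩ := exists_continuous_N n i p hp
  obtain ⟨G, hG, hD⟩ := exists_hasDerivAt_cumulBasis hp (integrable_N n i) hg hN
  rw [hN y (Ioo_subset_piece p hy)]
  refine (hG y).congr_of_eventuallyEq ?_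
  filter_upwards [Ioo_mem_nhds hy.1 hy.2] with z hz
  exact hD z (Ioo_subset_piece p hz)

/-! ### Local linear independence -/

theorem weight_ne_zero {n i : ℕ} (hpos : S.PosAt n) (h : S.IsDefined n i) :
    S.weight n i ≠ 0 := by
  rw [weight, if_pos h]
  exact inv_ne_zero ((hpos i).2 h).ne'

theorem sum_by_parts (c g : ℕ → ℝ) {b A : ℕ} (h : b + 1 ≤ A) :
    ∑ i ∈ Finset.Ioc b A, c i * (g i - g (i + 1)) + c A * g (A + 1) =
      c (b + 1) * g (b + 1) + ∑ i ∈ Finset.Ioc (b + 1) A, (c i - c (i - 1)) * g i := by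
  induction A, h using Nat.le_induction with
  | base => simp; ring
  | succ A hA ih =>
    rw [Finset.sum_Ioc_succ_top (by omega), Finset.sum_Ioc_succ_top (by omega), ← add_assoc, ← ih,
      Nat.add_sub_cancel]
    ring

/-- The derivative of a combination of the functions `N_{i,n+1}` inside a breakpoint interval. -/
theorem hasDerivAt_sum_N {n p b : ℕ} (hpos : ∀ n' < n + 1, S.PosAt n') (hp : p ≤ S.q)
    (hb : b + (n + 1) = S.rightCount p + S.m) (hd : S.m ≤ n + S.d p) (c : ℕ → ℝ) {y : ℝ}
    (hy : y ∈ Set.Ioo (S.x p) (S.x (p + 1))) :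
    HasDerivAt (fun y => ∑ i ∈ Finset.Ioc b (S.leftCount p), c i * S.N (n + 1) i y)
      (∑ i ∈ Finset.Ioc (b + 1) (S.leftCount p),
        (c i - c (i - 1)) * (S.weight n i * S.N n i y)) y := by
  have hA := S.leftCount_eq hp
  have hyp := Ioo_subset_piece p hy
  have h := sum_by_parts c (fun i => S.weight n i * S.N n i y) (b := b) (A := S.leftCount p)
    (by omega)
  -- Both boundary terms of the summation by parts lie just outside the window of level n.
  simp only [N_eq_zero (i := S.leftCount p + 1) (n := n) hp hyp (fun h => by have := h.2; omega),
    N_eq_zero (i := b + 1) (n := n) hp hyp (fun h => by have := h.1; omega), mul_zero,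
    add_zero, zero_add] at h
  rw [← h]
  have h2 : HasDerivAt (fun y => ∑ i ∈ Finset.Ioc b (S.leftCount p),
      c i * (S.cumulBasis (n + 1) i y - S.cumulBasis (n + 1) (i + 1) y))
      (∑ i ∈ Finset.Ioc b (S.leftCount p), c i * (S.weight n i * S.N n i y -
        S.weight n (i + 1) * S.N n (i + 1) y)) y :=
    HasDerivAt.fun_sum fun i _ =>
      ((hasDerivAt_cumulBasis hp hy).sub (hasDerivAt_cumulBasis hp hy)).const_mul _
  refine h2.congr_of_eventuallyEq ?_
  filter_upwards [Ioo_mem_nhds hy.1 hy.2] with z hz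
  refine Finset.sum_congr rfl fun i _ => ?_
  rw [N_eq hpos hp (Ioo_subset_piece p hz), if_pos (by omega)]

theorem deriv_eq_zero_of_const_on_Ioo {f : ℝ → ℝ} {u v e y f' : ℝ} (hf : HasDerivAt f f' y)
    (hy : y ∈ Set.Ioo u v) (h : ∀ z ∈ Set.Ioo u v, f z = e) : f' = 0 := by
  refine hf.unique ((hasDerivAt_const y e).congr_of_eventuallyEq ?_)
  filter_upwards [Ioo_mem_nhds hy.1 hy.2] with z hz using h z hz

/-- On a breakpoint interval, a combination of the functions `N_{i,n}` is constant only if all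
coefficients of functions supported there agree with the constant. -/
theorem coeff_eq_of_sum_eq_const {p : ℕ} (hp : p ≤ S.q) (n : ℕ) :
    ∀ (b : ℕ), (∀ n' < n, S.PosAt n') → b + n = S.rightCount p + S.m → S.m ≤ n + S.d p →
    ∀ (c : ℕ → ℝ) (e : ℝ), (∀ y ∈ Set.Ioo (S.x p) (S.x (p + 1)),
      ∑ i ∈ Finset.Ioc b (S.leftCount p), c i * S.N n i y = e) →
    ∀ i ∈ Finset.Ioc b (S.leftCount p), c i = e := by
  have hA := S.leftCount_eq hp
  obtain ⟨y, hy⟩ : (Set.Ioo (S.x p) (S.x (p + 1))).Nonempty :=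
    Set.nonempty_Ioo.2 (S.x_lt p hp)
  have hyp := Ioo_subset_piece p hy
  -- With equal coefficients the sum telescopes to that coefficient, since the first primitive is 1
  -- and the last is 0: partition of unity on the piece.
  have base : ∀ n b : ℕ, (∀ n' < n, S.PosAt n') → b + n = S.rightCount p + S.m →
      S.m ≤ n + S.d p →
      ∀ (c : ℕ → ℝ) (e : ℝ), (∀ i ∈ Finset.Ioc b (S.leftCount p), c i = c (b + 1)) →
      ∑ i ∈ Finset.Ioc b (S.leftCount p), c i * S.N n i y = e →
      ∀ i ∈ Finset.Ioc b (S.leftCount p), c i = e := by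
    intro n b hpos hb hd c e hc hs i hi
    rw [hc i hi, ← hs]
    rw [Finset.sum_congr rfl (g := fun i => (fun _ => c (b + 1)) i * (S.cumulBasis n i y -
      S.cumulBasis n (i + 1) y)) fun i hi => by rw [N_eq hpos hp hyp, if_pos hd, hc i hi]]
    have h := sum_by_parts (fun _ => c (b + 1)) (fun i => S.cumulBasis n i y) (b := b)
      (A := S.leftCount p) (by omega)
    simp only [sub_self, zero_mul, Finset.sum_const_zero, add_zero] at h
    rw [cumulBasis_eq_zero hp hyp (by omega), mul_zero, add_zero,
      cumulBasis_eq_one hpos hp hyp (by omega) (by omega), mul_one] at h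
    exact h.symm
  induction n with
  | zero =>
    intro b hpos hb hd c e h
    have := S.d_le_m hp
    refine base 0 b hpos hb hd c e (fun i hi => ?_) (h y hy)
    rw [Finset.mem_Ioc] at hi
    congr 1
    omega
  | succ n ih =>
    intro b hpos hb hd c e h
    refine base (n + 1) b hpos hb hd c e ?_ (h y hy)
    -- Here the window has one index and level n is not active on this piece, so there is nothing to
    -- differentiate.
    by_cases he : S.m = n + 1 + S.d p
    · intro i hi
      rw [Finset.mem_Ioc] at hi
      congr 1
      omega
    have hd' : S.m ≤ n + S.d p := by omega
    have hz := ih (b + 1) (fun n' hn' => hpos n' (by omega)) (by omega) hd'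
      (fun i => (c i - c (i - 1)) * S.weight n i) 0 fun z hz => by
        have := deriv_eq_zero_of_const_on_Ioo (hasDerivAt_sum_N hpos hp hb hd' c hz) hz h
        simpa only [mul_assoc] using this
    have hstep : ∀ i ∈ Finset.Ioc (b + 1) (S.leftCount p), c i = c (i - 1) := by
      intro i hi
      have h1 := hz i hi
      rw [Finset.mem_Ioc] at hi
      have h2 : S.IsDefined n i := isDefined_iff _ |>.2 ⟨p, hp, by omega, hi.2⟩
      exact sub_eq_zero.1 ((mul_eq_zero.1 h1).resolve_right
        (weight_ne_zero (hpos n (by omega)) h2))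
    intro i hi
    rw [Finset.mem_Ioc] at hi
    obtain ⟨h1, h2⟩ := hi
    induction i, h1 using Nat.le_induction with
    | base => rfl
    | succ i hi ih2 =>
      rw [hstep (i + 1) (Finset.mem_Ioc.2 ⟨by omega, h2⟩), Nat.add_sub_cancel, ih2 (by omega)]

end

section

variable {S : MDSpline} {j : ℕ}

/-! ### Lowering a continuity -/

theorem lower_k_of_ne {i : ℕ} (h : i ≠ j) : (S.lower j).k i = S.k i := by
  simp [lower, Function.update_of_ne h]

theorem lower_k_self : (S.lower j).k j = S.k j - 1 := by simp [lower]

theorem lower_leftCount_of_lt {p : ℕ} (h : p < j) :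
    (S.lower j).leftCount p = S.leftCount p := by
  induction p with
  | zero => simp [leftCount, lower]
  | succ p ih =>
    rw [leftCount_succ, leftCount_succ, ih (by omega), lower_k_of_ne h.ne]
    rfl

theorem lower_rightCount_of_lt {p : ℕ} (h : p < j) :
    (S.lower j).rightCount p = S.rightCount p := by
  induction p with
  | zero => simp [rightCount]
  | succ p ih =>
    rw [rightCount_succ, rightCount_succ, ih (by omega), lower_k_of_ne h.ne]
    rfl

theorem lower_leftCount_of_ge (hj : 1 ≤ j) (hjq : j ≤ S.q) (hk : 1 ≤ S.k j) {p : ℕ}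
    (h : j ≤ p) : (S.lower j).leftCount p = S.leftCount p + 1 := by
  induction p, h using Nat.le_induction with
  | base =>
    obtain ⟨j, rfl⟩ : ∃ i, j = i + 1 := ⟨j - 1, by omega⟩
    have := S.k_le_succ (p := j) (by omega)
    have hd : (S.lower (j + 1)).d = S.d := rfl
    rw [leftCount_succ, leftCount_succ, lower_leftCount_of_lt (by omega), lower_k_self, hd]
    omega
  | succ p hp ih =>
    rw [leftCount_succ, leftCount_succ, ih, lower_k_of_ne (by omega), add_right_comm]
    rfl

theorem lower_rightCount_of_ge (hj : 1 ≤ j) (hjq : j ≤ S.q) (hk : 1 ≤ S.k j) {p : ℕ}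
    (h : j ≤ p) : (S.lower j).rightCount p = S.rightCount p + 1 := by
  induction p, h using Nat.le_induction with
  | base =>
    obtain ⟨j, rfl⟩ : ∃ i, j = i + 1 := ⟨j - 1, by omega⟩
    have := S.k_le_succ (p := j) (by omega)
    have hd : (S.lower (j + 1)).d = S.d := rfl
    rw [rightCount_succ, rightCount_succ, lower_rightCount_of_lt (by omega), lower_k_self, hd]
    omega
  | succ p hp ih =>
    rw [rightCount_succ, rightCount_succ, ih, lower_k_of_ne (by omega), add_right_comm]
    rfl

theorem lower_active_of_lt {n i p : ℕ} (h : p < j) :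
    (S.lower j).Active n i p ↔ S.Active n i p := by
  rw [Active, Active, lower_leftCount_of_lt h, lower_rightCount_of_lt h]
  rfl

/-- The additional copy of x_j precedes this piece in both partitions, hence the index shift by one.
-/
theorem lower_active_of_ge (hj : 1 ≤ j) (hjq : j ≤ S.q) (hk : 1 ≤ S.k j) {n i p : ℕ}
    (h : j ≤ p) : (S.lower j).Active n (i + 1) p ↔ S.Active n i p := by
  have hm : (S.lower j).m = S.m := rfl
  rw [Active, Active, lower_leftCount_of_ge hj hjq hk h, lower_rightCount_of_ge hj hjq hk h, hm]
  omega

theorem not_active_of_gt {n i p : ℕ} (h : p < j) (hi : S.leftCount (j - 1) < i) :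
    ¬ S.Active n i p := by
  intro hA
  have := S.leftCount_mono (show p ≤ j - 1 by omega)
  have := hA.2
  omega

/-- The coefficients expressing the functions of level `n` through those of the space with
lowered continuity, together with their location. -/
def IsLevelRKI (S : MDSpline) (j n : ℕ) (α : ℕ → ℝ) : Prop :=
  (∀ i ≤ S.leftCount (j - 1), i + n ≤ S.rightCount j + 1 + S.m → α i = 1) ∧
  (∀ i ≤ S.leftCount (j - 1), S.rightCount j + 1 + S.m < i + n → α i ∈ Set.Ioo (0 : ℝ) 1) ∧
  (∀ i, S.leftCount (j - 1) < i → α i = 0) ∧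
  ∀ i, ∀ p ≤ S.q, ∀ y ∈ S.piece p, S.cumulBasis n i y =
    α i * (S.lower j).cumulBasis n i y + (1 - α i) * (S.lower j).cumulBasis n (i + 1) y

theorem IsLevelRKI.mem_Icc {n : ℕ} {α : ℕ → ℝ} (h : S.IsLevelRKI j n α) (i : ℕ) :
    α i ∈ Set.Icc (0 : ℝ) 1 := by
  obtain ⟨h1, h2, h3, -⟩ := h
  by_cases hi : i ≤ S.leftCount (j - 1)
  · by_cases hi' : i + n ≤ S.rightCount j + 1 + S.m
    · rw [h1 i hi hi']; simp
    · exact Set.Ioo_subset_Icc_self (h2 i hi (by omega))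
  · rw [h3 i (by omega)]; simp

/-- Subtract the identities for i and i + 1 and regroup: the term with index i + 1 collects (1 -
α_i) - α_{i+1}, which splits between the two differences. -/
theorem IsLevelRKI.N_eq {n : ℕ} {α : ℕ → ℝ} (h : S.IsLevelRKI j n α)
    (hpos : ∀ n' < n, S.PosAt n') (hpos' : ∀ n' < n, (S.lower j).PosAt n') (i : ℕ) (y : ℝ) :
    S.N n i y = α i * (S.lower j).N n i y + (1 - α (i + 1)) * (S.lower j).N n (i + 1) y := by
  by_cases hy : ∃ p ≤ S.q, y ∈ S.piece p
  · obtain ⟨p, hp, hy⟩ := hy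
    have hy' : y ∈ (S.lower j).piece p := hy
    rw [MDSpline.N_eq hpos hp hy, MDSpline.N_eq hpos' hp hy', MDSpline.N_eq hpos' hp hy',
      h.2.2.2 i p hp y hy, h.2.2.2 (i + 1) p hp y hy]
    have hm : (S.lower j).m = S.m := rfl
    have hd : (S.lower j).d = S.d := rfl
    rw [hm, hd]
    split_ifs
    · ring
    · ring
  · push Not at hy
    have hy' : ∀ p ≤ (S.lower j).q, y ∉ (S.lower j).piece p := hy
    rw [N_outside hy, N_outside hy', N_outside hy', mul_zero, mul_zero, add_zero]

theorem IsLevelRKI.integral_eq {n : ℕ} {α : ℕ → ℝ} (h : S.IsLevelRKI j n α)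
    (hpos : ∀ n' < n, S.PosAt n') (hpos' : ∀ n' < n, (S.lower j).PosAt n') (i : ℕ) :
    ∫ u, S.N n i u = α i * (∫ u, (S.lower j).N n i u) +
      (1 - α (i + 1)) * ∫ u, (S.lower j).N n (i + 1) u := by
  rw [← integral_const_mul, ← integral_const_mul, ← integral_add
    ((integrable_N n i).const_mul _) ((integrable_N n (i + 1)).const_mul _)]
  exact integral_congr_ae (Filter.Eventually.of_forall fun y => h.N_eq hpos hpos' i y)

theorem IsLevelRKI.setIntegral_eq {n : ℕ} {α : ℕ → ℝ} (h : S.IsLevelRKI j n α)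
    (hpos : ∀ n' < n, S.PosAt n') (hpos' : ∀ n' < n, (S.lower j).PosAt n') (i : ℕ) (y : ℝ) :
    ∫ u in Set.Iic y, S.N n i u = α i * (∫ u in Set.Iic y, (S.lower j).N n i u) +
      (1 - α (i + 1)) * ∫ u in Set.Iic y, (S.lower j).N n (i + 1) u := by
  rw [← integral_const_mul, ← integral_const_mul, ← integral_add
    ((integrable_N n i).const_mul _).integrableOn
    ((integrable_N n (i + 1)).const_mul _).integrableOn]
  exact integral_congr_ae (Filter.Eventually.of_forall fun y => h.N_eq hpos hpos' i y)

theorem integral_nonneg_of_posAt {n : ℕ} (h : S.PosAt n) (i : ℕ) : 0 ≤ ∫ u, S.N n i u :=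
  integral_nonneg (h i).1

/-- If N_{i,n} lives left of x_j, then α_i > 0 and N̂_{i,n} is defined; if it lives right of x_j,
then 1 - α_{i+1} > 0 and N̂_{i+1,n} is defined. Either way one summand of the integral is positive.
-/
theorem IsLevelRKI.posAt {n : ℕ} {α : ℕ → ℝ} (hj : 1 ≤ j) (hjq : j ≤ S.q) (hk : 1 ≤ S.k j)
    (h : S.IsLevelRKI j n α) (hpos : ∀ n' < n, S.PosAt n')
    (hpos' : ∀ n' ≤ n, (S.lower j).PosAt n') : S.PosAt n := by
  have hlt : ∀ n' < n, (S.lower j).PosAt n' := fun n' hn => hpos' n' hn.le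
  have hP := hpos' n le_rfl
  intro i
  have h0 := h.mem_Icc i
  have h1 := h.mem_Icc (i + 1)
  refine ⟨fun y => ?_, fun hdef => ?_⟩
  · rw [h.N_eq hpos hlt]
    exact add_nonneg (mul_nonneg h0.1 ((hP i).1 y))
      (mul_nonneg (sub_nonneg.2 h1.2) ((hP (i + 1)).1 y))
  · rw [h.integral_eq hpos hlt]
    obtain ⟨p, hp, hA⟩ := isDefined_iff S |>.1 hdef
    rcases lt_or_ge p j with hpj | hpj
    · have hI : 0 < ∫ u, (S.lower j).N n i u :=
        (hP i).2 (isDefined_iff _ |>.2 ⟨p, hp, (lower_active_of_lt hpj).2 hA⟩)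
      have hi : i ≤ S.leftCount (j - 1) := by
        by_contra! hc
        exact not_active_of_gt hpj hc hA
      have hα : 0 < α i := by
        by_cases hi' : i + n ≤ S.rightCount j + 1 + S.m
        · rw [h.1 i hi hi']; exact one_pos
        · exact (h.2.1 i hi (by omega)).1
      exact add_pos_of_pos_of_nonneg (mul_pos hα hI)
        (mul_nonneg (sub_nonneg.2 h1.2) (integral_nonneg_of_posAt hP _))
    · have hI : 0 < ∫ u, (S.lower j).N n (i + 1) u :=
        (hP (i + 1)).2 (isDefined_iff _ |>.2 ⟨p, hp, (lower_active_of_ge hj hjq hk hpj).2 hA⟩)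
      have hα : α (i + 1) < 1 := by
        by_cases hi : i + 1 ≤ S.leftCount (j - 1)
        · have := S.rightCount_mono hpj
          have := hA.1
          exact (h.2.1 (i + 1) hi (by omega)).2
        · rw [h.2.2.1 (i + 1) (by omega)]; exact one_pos
      exact add_pos_of_nonneg_of_pos (mul_nonneg h0.1 (integral_nonneg_of_posAt hP _))
        (mul_pos (sub_pos.2 hα) hI)

theorem leftCount_pred (hj : 1 ≤ j) (hjq : j ≤ S.q) :
    S.leftCount (j - 1) = S.rightCount j + S.k j + 1 := by
  have := S.rightCount_succ_add (p := j - 1) (by omega)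
  rw [Nat.sub_add_cancel hj] at this
  exact this.symm

open Classical in
-- Level 0 consists of step functions at the s_i, which keep their index before the new copy of x_j
-- and shift by one from there on. The range for weights strictly between 0 and 1 is empty because
-- k_j ≤ m.
theorem isLevelRKI_zero (hj : 1 ≤ j) (hjq : j ≤ S.q) (hk : 1 ≤ S.k j) :
    S.IsLevelRKI j 0 (fun i => if i ≤ S.leftCount (j - 1) then 1 else 0) := by
  have hT := leftCount_pred hj hjq
  have hkm : S.k j ≤ S.m :=
    (S.k_le j (Finset.mem_Icc.2 ⟨hj, hjq⟩)).trans ((min_le_right _ _).trans (S.d_le_m hjq))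
  refine ⟨fun i hi _ => if_pos hi, fun i hi h => by omega, fun i hi => if_neg (by omega), ?_⟩
  intro i p hp y hy
  have hy' : y ∈ (S.lower j).piece p := hy
  have e1 : S.cumulBasis 0 i y = if i ≤ S.leftCount p then 1 else 0 :=
    if_congr (step_iff hp hy) rfl rfl
  have e2 : ∀ i, (S.lower j).cumulBasis 0 i y =
      if i ≤ (S.lower j).leftCount p then 1 else 0 :=
    fun i => if_congr (step_iff (S := S.lower j) hp hy') rfl rfl
  rw [e1, e2, e2]
  rcases lt_or_ge p j with hpj | hpj
  · have := S.leftCount_mono (show p ≤ j - 1 by omega)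
    rw [lower_leftCount_of_lt hpj]
    split_ifs <;> first | omega | (norm_num <;> omega)
  · have := S.leftCount_mono (show j - 1 ≤ p by omega)
    rw [lower_leftCount_of_ge hj hjq hk hpj]
    split_ifs <;> first | omega | (norm_num <;> omega)

theorem cumulBasis_congr {S' : MDSpline} {n i i' p : ℕ} (hp : p ≤ S.q) (hp' : p ≤ S'.q) {y : ℝ}
    (hy : y ∈ S.piece p) (hy' : y ∈ S'.piece p) (hdef : S.IsDefined n i ↔ S'.IsDefined n i')
    (hN : S.N n i = S'.N n i') (hi : i ≤ S.leftCount p ↔ i' ≤ S'.leftCount p) :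
    S.cumulBasis (n + 1) i y = S'.cumulBasis (n + 1) i' y := by
  classical
  by_cases h : S.IsDefined n i
  · rw [cumulBasis, cumulBasis, cumul, cumul, if_pos h, if_pos (hdef.1 h), hN]
  · rw [cumulBasis_undefined hp hy h, cumulBasis_undefined hp' hy' fun h' => h (hdef.2 h')]
    exact if_congr hi rfl rfl

theorem IsLevelRKI.succ {n : ℕ} {α : ℕ → ℝ} (hj : 1 ≤ j) (hjq : j ≤ S.q) (hk : 1 ≤ S.k j)
    (h : S.IsLevelRKI j n α) (hpos : ∀ n' < n, S.PosAt n')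
    (hpos' : ∀ n' ≤ n, (S.lower j).PosAt n') : ∃ β, S.IsLevelRKI j (n + 1) β := by
  classical
  have hlt : ∀ n' < n, (S.lower j).PosAt n' := fun n' hn => hpos' n' hn.le
  have hP := hpos' n le_rfl
  have hPS := h.posAt hj hjq hk hpos hpos'
  -- The cases are: support right of x_j, where N_{i,n} is N̂_{i+1,n}; support left of x_j, where it
  -- is N̂_{i,n}; and support crossing x_j, where the weight is the share of the first summand in
  -- the integral of N_{i,n}.
  set β : ℕ → ℝ := fun i => if S.leftCount (j - 1) < i then 0
    else if i + n ≤ S.rightCount j + S.m then 1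
    else α i * (∫ u, (S.lower j).N n i u) / ∫ u, S.N n i u with hβ
  have hmid : ∀ i ≤ S.leftCount (j - 1), S.rightCount j + S.m < i + n →
      S.IsDefined n i ∧ (S.lower j).IsDefined n i ∧ (S.lower j).IsDefined n (i + 1) ∧
      0 < α i ∧ α (i + 1) < 1 := by
    intro i hi hi'
    have hA : S.Active n i (j - 1) :=
      ⟨by have := S.rightCount_mono (Nat.sub_le j 1); omega, hi⟩
    have hA' : S.Active n i j := ⟨hi', hi.trans (S.leftCount_mono (Nat.sub_le j 1))⟩
    refine ⟨isDefined_iff _ |>.2 ⟨j, hjq, hA'⟩,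
      isDefined_iff _ |>.2 ⟨j - 1, (by change j - 1 ≤ S.q; omega),
        (lower_active_of_lt (by omega)).2 hA⟩,
      isDefined_iff _ |>.2 ⟨j, hjq, (lower_active_of_ge hj hjq hk le_rfl).2 hA'⟩, ?_, ?_⟩
    · by_cases h1 : i + n ≤ S.rightCount j + 1 + S.m
      · rw [h.1 i hi h1]; exact one_pos
      · exact (h.2.1 i hi (by omega)).1
    · by_cases h1 : i + 1 ≤ S.leftCount (j - 1)
      · exact (h.2.1 (i + 1) h1 (by omega)).2
      · rw [h.2.2.1 (i + 1) (by omega)]; exact one_pos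
  refine ⟨β, fun i hi hi' => ?_, fun i hi hi' => ?_, fun i hi => ?_, fun i p hp y hy => ?_⟩
  · simp only [hβ]
    rw [if_neg (by omega), if_pos (by omega)]
  · simp only [hβ]
    rw [if_neg (by omega), if_neg (by omega)]
    obtain ⟨d1, d2, d3, a1, a2⟩ := hmid i hi (by omega)
    have I1 := (hPS i).2 d1
    have J1 := mul_pos a1 ((hP i).2 d2)
    have J2 := mul_pos (sub_pos.2 a2) ((hP (i + 1)).2 d3)
    refine ⟨div_pos J1 I1, (div_lt_one I1).2 ?_⟩
    rw [h.integral_eq hpos hlt]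
    linarith
  · simp only [hβ]
    rw [if_pos hi]
  · have hy' : y ∈ (S.lower j).piece p := hy
    have hp' : p ≤ (S.lower j).q := hp
    have hq : (S.lower j).q = S.q := rfl
    by_cases hi : S.leftCount (j - 1) < i
    · simp only [hβ]
      rw [if_pos hi, zero_mul, zero_add, sub_zero, one_mul]
      have hact : ∀ r, S.Active n i r ↔ (S.lower j).Active n (i + 1) r := by
        intro r
        rcases lt_or_ge r j with hr | hr
        · rw [lower_active_of_lt hr]
          exact iff_of_false (not_active_of_gt hr hi) (not_active_of_gt hr (by omega))
        · rw [lower_active_of_ge hj hjq hk hr]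
      refine cumulBasis_congr hp hp' hy hy' ?_ ?_ ?_
      · simp only [isDefined_iff, hact, hq]
      · funext z
        rw [h.N_eq hpos hlt, h.2.2.1 i hi, h.2.2.1 (i + 1) (by omega)]
        ring
      · rcases lt_or_ge p j with hr | hr
        · have := S.leftCount_mono (show p ≤ j - 1 by omega)
          rw [lower_leftCount_of_lt hr]
          omega
        · rw [lower_leftCount_of_ge hj hjq hk hr]
          omega
    by_cases hi' : i + n ≤ S.rightCount j + S.m
    · simp only [hβ]
      rw [if_neg hi, if_pos hi', one_mul, sub_self, zero_mul, add_zero]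
      have hnot : ∀ i', i' ≤ i → ∀ r, j ≤ r → ¬ S.Active n i' r := by
        intro i' hii r hr hA
        have := S.rightCount_mono hr
        have := hA.1
        omega
      have hnot' : ∀ i', i' ≤ i + 1 → ∀ r, j ≤ r → ¬ (S.lower j).Active n i' r := by
        intro i' hii r hr hA
        have := S.rightCount_mono hr
        have := hA.1
        have hm : (S.lower j).m = S.m := rfl
        rw [lower_rightCount_of_ge hj hjq hk hr, hm] at this
        omega
      have hact : ∀ r, S.Active n i r ↔ (S.lower j).Active n i r := by
        intro r
        rcases lt_or_ge r j with hr | hr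
        · rw [lower_active_of_lt hr]
        · exact iff_of_false (hnot i le_rfl r hr) (hnot' i (by omega) r hr)
      refine cumulBasis_congr hp hp' hy hy' ?_ ?_ ?_
      · simp only [isDefined_iff, hact, hq]
      · funext z
        rw [h.N_eq hpos hlt, h.1 i (by omega) (by omega)]
        by_cases hi1 : i + 1 ≤ S.leftCount (j - 1)
        · rw [h.1 (i + 1) hi1 (by omega)]
          ring
        -- Here α_{i+1} = 0, so the second term keeps its full coefficient; it vanishes because this
        -- function has no active piece on either side of x_j.
        · have : (S.lower j).N n (i + 1) z = 0 := by
            by_cases hz : ∃ r ≤ S.q, z ∈ S.piece r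
            · obtain ⟨r, hr, hz⟩ := hz
              refine MDSpline.N_eq_zero (S := S.lower j) (p := r) hr hz ?_
              rcases lt_or_ge r j with hrj | hrj
              · rw [lower_active_of_lt hrj]
                exact not_active_of_gt hrj (by omega)
              · exact hnot' (i + 1) le_rfl r hrj
            · push Not at hz
              exact N_outside (S := S.lower j) hz
          rw [this]
          ring
      · rcases lt_or_ge p j with hr | hr
        · rw [lower_leftCount_of_lt hr]
        · have := S.leftCount_mono (show j - 1 ≤ p by omega)
          rw [lower_leftCount_of_ge hj hjq hk hr]
          omega
    · obtain ⟨d1, d2, d3, a1, a2⟩ := hmid i (by omega) (by omega)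
      simp only [hβ]
      rw [if_neg hi, if_neg hi']
      simp only [cumulBasis, cumul]
      rw [if_pos d1, if_pos d2, if_pos d3, h.setIntegral_eq hpos hlt]
      have I1 := (hPS i).2 d1
      have J1 := (hP i).2 d2
      have J2 := (hP (i + 1)).2 d3
      have hI := h.integral_eq hpos hlt i
      have h1 : 1 - α i * (∫ u, (S.lower j).N n i u) / ∫ u, S.N n i u =
          (1 - α (i + 1)) * (∫ u, (S.lower j).N n (i + 1) u) / ∫ u, S.N n i u := by
        rw [eq_div_iff I1.ne', sub_mul, div_mul_cancel₀ _ I1.ne', hI]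
        ring
      rw [h1]
      field_simp

/-- Positivity and coefficients must climb together: level n + 1 divides by integrals of level n,
whose positivity comes from the coefficients of level n. -/
theorem exists_isLevelRKI (hj : 1 ≤ j) (hjq : j ≤ S.q) (hk : 1 ≤ S.k j) (n : ℕ)
    (hpos' : ∀ n' < n, (S.lower j).PosAt n') :
    (∀ n' < n, S.PosAt n') ∧ ∃ α, S.IsLevelRKI j n α := by
  induction n with
  | zero => exact ⟨fun n' hn => absurd hn (Nat.not_lt_zero _), _, isLevelRKI_zero hj hjq hk⟩
  | succ n ih =>
    obtain ⟨hpos, α, hα⟩ := ih fun n' hn => hpos' n' (by omega)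
    have hle : ∀ n' ≤ n, (S.lower j).PosAt n' := fun n' hn => hpos' n' (by omega)
    refine ⟨fun n' hn => ?_, hα.succ hj hjq hk hpos hle⟩
    rcases (Nat.lt_succ_iff.1 hn).eq_or_lt with rfl | hn'
    · exact hα.posAt hj hjq hk hpos hle
    · exact hpos n' hn'

end

section

variable {S : MDSpline}

/-! ### Positivity -/

/-- Upper partial sums of Bernstein polynomials. -/
def bernsteinTail (D ν : ℕ) : Polynomial ℝ :=
  ∑ μ ∈ Finset.Ico ν (D + 1), bernsteinPolynomial ℝ D μ

theorem bernsteinTail_zero (D : ℕ) : bernsteinTail D 0 = 1 := by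
  rw [bernsteinTail, ← Finset.range_eq_Ico, bernsteinPolynomial.sum]

theorem bernsteinTail_of_gt {D ν : ℕ} (h : D < ν) : bernsteinTail D ν = 0 := by
  rw [bernsteinTail, Finset.Ico_eq_empty_of_le (by omega), Finset.sum_empty]

theorem bernsteinTail_sub {D ν : ℕ} (h : ν ≤ D) :
    bernsteinTail D ν - bernsteinTail D (ν + 1) = bernsteinPolynomial ℝ D ν := by
  rw [bernsteinTail, bernsteinTail, Finset.sum_eq_sum_Ico_succ_bot (by omega), add_sub_cancel_right]

/-- Each derivative is a difference of neighbouring Bernstein polynomials of lower degree, so the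
tail telescopes. Tails thus play the role of the normalized primitives. -/
theorem derivative_bernsteinTail (D ν : ℕ) :
    Polynomial.derivative (bernsteinTail (D + 1) (ν + 1)) =
      (D + 1 : Polynomial ℝ) * bernsteinPolynomial ℝ D ν := by
  have key : ∀ (f : ℕ → Polynomial ℝ) (M : ℕ), ν ≤ M →
      ∑ i ∈ Finset.Ico ν M, (f i - f (i + 1)) = f ν - f M := by
    intro f M hM
    induction M, hM using Nat.le_induction with
    | base => simp
    | succ M hM ih => rw [Finset.sum_Ico_succ_top hM, ih]; ring
  rcases Nat.lt_or_ge D ν with h | h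
  · rw [bernsteinTail_of_gt (by omega), bernsteinPolynomial.eq_zero_of_lt _ h]
    simp
  · rw [bernsteinTail, ← Finset.sum_Ico_add', Polynomial.derivative_sum]
    simp only [bernsteinPolynomial.derivative_succ]
    rw [← Finset.mul_sum, Nat.add_sub_cancel, key _ _ (by omega),
      bernsteinPolynomial.eq_zero_of_lt _ (Nat.lt_succ_self D), sub_zero]
    push_cast
    rfl

theorem bernsteinTail_succ_eval_zero (D ν : ℕ) : (bernsteinTail D (ν + 1)).eval 0 = 0 := by
  rw [bernsteinTail, Polynomial.eval_finsetSum]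
  refine Finset.sum_eq_zero fun μ hμ => ?_
  rw [bernsteinPolynomial.eval_at_0, if_neg]
  rw [Finset.mem_Ico] at hμ
  omega

theorem bernsteinTail_eval_one {D ν : ℕ} (h : ν ≤ D) : (bernsteinTail D ν).eval 1 = 1 := by
  rw [bernsteinTail, Polynomial.eval_finsetSum, Finset.sum_eq_single D]
  · rw [bernsteinPolynomial.eval_at_1, if_pos rfl]
  · intro μ _ hne
    rw [bernsteinPolynomial.eval_at_1, if_neg hne]
  · intro hD
    exact absurd (Finset.mem_Ico.2 ⟨h, Nat.lt_succ_self D⟩) hD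

theorem bernsteinPolynomial_eval_nonneg (D ν : ℕ) {u : ℝ} (h0 : 0 ≤ u) (h1 : u ≤ 1) :
    0 ≤ (bernsteinPolynomial ℝ D ν).eval u := by
  have := sub_nonneg.2 h1
  simp only [bernsteinPolynomial, Polynomial.eval_mul, Polynomial.eval_pow, Polynomial.eval_sub,
    Polynomial.eval_X, Polynomial.eval_one, Polynomial.eval_natCast]
  positivity

/-- With continuity 0, neighbouring windows share one index at the top level and none below it. -/
theorem active_unique (hk : ∀ i ∈ Finset.Icc 1 S.q, S.k i = 0) {n i p r : ℕ} (hn : n < S.m)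
    (hp : p ≤ S.q) (hr : r ≤ S.q) (h : S.Active n i p) (h' : S.Active n i r) : p = r := by
  have key : ∀ {p r : ℕ}, r ≤ S.q → S.Active n i p → S.Active n i r → ¬ p < r := by
    intro p r hr h h' hlt
    have h1 := S.rightCount_succ_add (p := p) (by omega)
    rw [hk (p + 1) (Finset.mem_Icc.2 ⟨by omega, by omega⟩)] at h1
    have h2 := S.rightCount_mono (show p + 1 ≤ r from hlt)
    have h3 := h.2
    have h4 := h'.1
    omega
  rcases lt_trichotomy p r with h1 | h1 | h1
  · exact absurd h1 (key hr h h')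
  · exact h1
  · exact absurd h1 (key hp h' h)

theorem integral_bernstein {n i p D ν : ℕ} (hp : p ≤ S.q)
    (hN : ∀ y ∈ S.piece p, S.N n i y =
      (bernsteinPolynomial ℝ D ν).eval ((y - S.x p) / (S.x (p + 1) - S.x p)))
    {y : ℝ} (hy : S.x p ≤ y) (hy' : y ≤ S.x (p + 1)) :
    ∫ u in S.x p..y, S.N n i u = (S.x (p + 1) - S.x p) / (D + 1) *
      (bernsteinTail (D + 1) (ν + 1)).eval ((y - S.x p) / (S.x (p + 1) - S.x p)) := by
  have hh : 0 < S.x (p + 1) - S.x p := sub_pos.2 (S.x_lt p hp)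
  have hD : (0 : ℝ) < D + 1 := by positivity
  have h1 : ∫ u in S.x p..y, S.N n i u = ∫ u in S.x p..y,
      (bernsteinPolynomial ℝ D ν).eval ((u - S.x p) / (S.x (p + 1) - S.x p)) := by
    rw [intervalIntegral.integral_of_le hy, intervalIntegral.integral_of_le hy,
      integral_Ioc_eq_integral_Ioo, integral_Ioc_eq_integral_Ioo]
    exact setIntegral_congr_fun measurableSet_Ioo fun z hz =>
      hN z (Ioo_subset_piece p ⟨hz.1, hz.2.trans_le hy'⟩)
  have h2 : ∀ z, HasDerivAt (fun z => (S.x (p + 1) - S.x p) / (D + 1) *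
      (bernsteinTail (D + 1) (ν + 1)).eval ((z - S.x p) / (S.x (p + 1) - S.x p)))
      ((bernsteinPolynomial ℝ D ν).eval ((z - S.x p) / (S.x (p + 1) - S.x p))) z := by
    intro z
    have h3 : HasDerivAt (fun z => (z - S.x p) / (S.x (p + 1) - S.x p))
        (1 / (S.x (p + 1) - S.x p)) z := ((hasDerivAt_id z).sub_const _).div_const _
    have h4 := (((bernsteinTail (D + 1) (ν + 1)).hasDerivAt _).comp z h3).const_mul
      ((S.x (p + 1) - S.x p) / (D + 1))
    refine h4.congr_deriv ?_
    rw [derivative_bernsteinTail, Polynomial.eval_mul]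
    simp only [Polynomial.eval_add, Polynomial.eval_natCast, Polynomial.eval_one]
    field_simp
  rw [h1, intervalIntegral.integral_eq_sub_of_hasDerivAt (fun z _ => h2 z)
    (Continuous.intervalIntegrable (by fun_prop) _ _), sub_self, zero_div,
    bernsteinTail_succ_eval_zero, mul_zero, sub_zero]

theorem integral_eq_of_single_piece {n i p : ℕ} (hp : p ≤ S.q)
    (h : ∀ r ≤ S.q, r ≠ p → ¬ S.Active n i r) :
    (∫ u, S.N n i u = ∫ u in S.x p..S.x (p + 1), S.N n i u) ∧
      ∫ u in Set.Iic (S.x p), S.N n i u = 0 := by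
  have h0 : ∀ y, y ∉ S.piece p → S.N n i y = 0 := by
    intro y hy
    by_cases hz : ∃ r ≤ S.q, y ∈ S.piece r
    · obtain ⟨r, hr, hz⟩ := hz
      exact N_eq_zero hr hz (h r hr fun e => hy (e ▸ hz))
    · push Not at hz
      exact N_outside hz
  constructor
  · rw [intervalIntegral.integral_of_le (S.x_lt p hp).le, ← integral_Icc_eq_integral_Ioc,
      setIntegral_eq_integral_of_forall_compl_eq_zero]
    exact fun y hy => h0 y fun hy' => hy (piece_subset_Icc hp hy')
  · rw [integral_Iic_eq_integral_Iio]
    exact setIntegral_eq_zero_of_forall_eq_zero fun y hy =>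
      h0 y fun hy' => absurd hy'.1 (not_le.2 hy)

/-- With all continuities `0`, the functions of level `n < m` are Bernstein polynomials. -/
theorem cumulBasis_eq_bernsteinTail (hk : ∀ i ∈ Finset.Icc 1 S.q, S.k i = 0) (n : ℕ)
    (hn : n ≤ S.m) :
    (∀ n' < n, S.PosAt n') ∧ ∀ p ≤ S.q, S.m ≤ n + S.d p → ∀ i,
      S.rightCount p + S.m + 1 ≤ i + n → ∀ y ∈ S.piece p, S.cumulBasis n i y =
        (bernsteinTail (n + S.d p - S.m) (i + n - (S.rightCount p + S.m + 1))).eval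
          ((y - S.x p) / (S.x (p + 1) - S.x p)) := by
  induction n with
  | zero =>
    have hpos : ∀ n' < 0, S.PosAt n' := fun n' h => absurd h (Nat.not_lt_zero _)
    refine ⟨hpos, fun p hp hd i hi y hy => ?_⟩
    have := S.leftCount_eq hp
    have := S.d_le_m hp
    rcases Nat.lt_or_ge (S.rightCount p + S.m + 1) i with h | h
    · rw [cumulBasis_eq_zero hp hy (by omega), bernsteinTail_of_gt (by omega),
        Polynomial.eval_zero]
    · rw [cumulBasis_eq_one hpos hp hy (by omega) (by omega),
        show i + 0 - (S.rightCount p + S.m + 1) = 0 by omega, bernsteinTail_zero,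
        Polynomial.eval_one]
  | succ n ih =>
    obtain ⟨hpos, ih⟩ := ih (by omega)
    have hN : ∀ p ≤ S.q, ∀ i, S.Active n i p → ∀ y ∈ S.piece p, S.N n i y =
        (bernsteinPolynomial ℝ (n + S.d p - S.m) (i + n - (S.rightCount p + S.m + 1))).eval
          ((y - S.x p) / (S.x (p + 1) - S.x p)) := by
      intro p hp i hA y hy
      have := S.leftCount_eq hp
      have hd := hA.le hp
      obtain ⟨h1, h2⟩ := hA
      rw [N_eq hpos hp hy, if_pos hd, ih p hp hd i (by omega) y hy,
        ih p hp hd (i + 1) (by omega) y hy, ← Polynomial.eval_sub,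
        show i + 1 + n - (S.rightCount p + S.m + 1) =
          i + n - (S.rightCount p + S.m + 1) + 1 by omega, bernsteinTail_sub (by omega)]
    have hint : ∀ p ≤ S.q, ∀ i, S.Active n i p → (∫ u, S.N n i u =
        (S.x (p + 1) - S.x p) / ((n + S.d p - S.m : ℕ) + 1)) ∧
        ∫ u in Set.Iic (S.x p), S.N n i u = 0 := by
      intro p hp i hA
      have hd := hA.le hp
      have := S.leftCount_eq hp
      obtain ⟨h1, h2⟩ := id hA
      have hh : S.x (p + 1) - S.x p ≠ 0 := (sub_pos.2 (S.x_lt p hp)).ne'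
      obtain ⟨h3, h4⟩ := integral_eq_of_single_piece hp fun r hr hne hr' =>
        hne (active_unique hk (by omega) hr hp hr' hA)
      refine ⟨?_, h4⟩
      rw [h3, integral_bernstein hp (hN p hp i hA) (S.x_lt p hp).le le_rfl, div_self hh,
        bernsteinTail_eval_one (by omega), mul_one]
    have hPn : S.PosAt n := by
      intro i
      refine ⟨fun y => ?_, fun hdef => ?_⟩
      · by_cases hz : ∃ r ≤ S.q, y ∈ S.piece r
        · obtain ⟨r, hr, hz⟩ := hz
          by_cases hA : S.Active n i r
          · rw [hN r hr i hA y hz]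
            have hh := sub_pos.2 (S.x_lt r hr)
            have h1 := piece_subset_Icc hr hz
            exact bernsteinPolynomial_eval_nonneg _ _
              (div_nonneg (sub_nonneg.2 h1.1) hh.le)
              ((div_le_one hh).2 (sub_le_sub_right h1.2 _))
          · rw [N_eq_zero hr hz hA]
        · push Not at hz
          rw [N_outside hz]
      · obtain ⟨p, hp, hA⟩ := isDefined_iff S |>.1 hdef
        rw [(hint p hp i hA).1]
        have hh := sub_pos.2 (S.x_lt p hp)
        positivity
    have hpos' : ∀ n' < n + 1, S.PosAt n' := by
      intro n' hn'
      rcases (Nat.lt_succ_iff.1 hn').eq_or_lt with rfl | h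
      · exact hPn
      · exact hpos n' h
    refine ⟨hpos', fun p hp hd i hi y hy => ?_⟩
    have hA := S.leftCount_eq hp
    rcases Nat.lt_or_ge (S.leftCount p) i with h | h
    · rw [cumulBasis_eq_zero hp hy h, bernsteinTail_of_gt (by omega), Polynomial.eval_zero]
    rcases hi.eq_or_lt with h1 | h1
    · rw [cumulBasis_eq_one hpos' hp hy h (by omega), h1, Nat.sub_self, bernsteinTail_zero,
        Polynomial.eval_one]
    have hact : S.Active n i p := ⟨by omega, h⟩
    obtain ⟨h2, h3⟩ := hint p hp i hact
    have hdef : S.IsDefined n i := isDefined_iff S |>.2 ⟨p, hp, hact⟩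
    have hle := hact.le hp
    have hh := sub_pos.2 (S.x_lt p hp)
    -- The function lives on piece p alone, so its primitive starts from 0 at x_p and equals the
    -- normalized Bernstein integral there.
    have h4 : S.cumulBasis (n + 1) i (S.x p) = 0 := by
      rw [cumulBasis, cumul, if_pos hdef, h3, mul_zero]
    have hy2 := piece_subset_Icc hp hy
    rw [cumulBasis_succ_eq hp (integrable_N n i) hy, h4, zero_add,
      integral_bernstein hp (hN p hp i hact) hy2.1 hy2.2, weight, if_pos hdef, h2, ← mul_assoc,
      inv_mul_cancel₀ (by positivity), one_mul,
      show n + S.d p - S.m + 1 = n + 1 + S.d p - S.m by omega,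
      show i + n - (S.rightCount p + S.m + 1) + 1 = i + (n + 1) - (S.rightCount p + S.m + 1)
        by omega]

/-- Induction on the total continuity: lowering any nonzero k_j reduces the sum by one, down to the
Bernstein case. -/
theorem posAt_of_lt_aux (c : ℕ) : ∀ S : MDSpline, ∑ i ∈ Finset.Icc 1 S.q, S.k i = c →
    ∀ n < S.m, S.PosAt n := by
  induction c with
  | zero =>
    intro S hS n hn
    refine (cumulBasis_eq_bernsteinTail (S := S) (fun i hi => ?_) S.m le_rfl).1 n hn
    exact (Finset.sum_eq_zero_iff.1 hS) i hi
  | succ c ih =>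
    intro S hS n hn
    obtain ⟨j, hj, hk⟩ : ∃ j ∈ Finset.Icc 1 S.q, S.k j ≠ 0 :=
      Finset.exists_ne_zero_of_sum_ne_zero (by omega)
    obtain ⟨hj1, hjq⟩ := Finset.mem_Icc.1 hj
    have hsum : ∑ i ∈ Finset.Icc 1 (S.lower j).q, (S.lower j).k i = c := by
      have h1 := Finset.add_sum_erase _ S.k hj
      have h2 := Finset.add_sum_erase _ (S.lower j).k hj
      rw [Finset.sum_congr rfl (g := fun i => S.k i)
        fun i hi => lower_k_of_ne (Finset.ne_of_mem_erase hi), lower_k_self] at h2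
      change ∑ i ∈ Finset.Icc 1 S.q, (S.lower j).k i = c
      omega
    exact (exists_isLevelRKI hj1 hjq (by omega) S.m fun n' hn' =>
      ih (S.lower j) hsum n' hn').1 n hn

theorem posAt_of_lt {n : ℕ} (hn : n < S.m) : S.PosAt n :=
  posAt_of_lt_aux _ S rfl n hn

end

section

variable {S : MDSpline} {j : ℕ}

/-! ### Coefficients with respect to the basis -/

theorem exists_active {i : ℕ} (hi : i ∈ Finset.Icc 1 S.K) : ∃ p ≤ S.q, S.Active S.m i p := by
  classical
  obtain ⟨h1, h2⟩ := Finset.mem_Icc.1 hi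
  have hex : ∃ p, i ≤ S.leftCount p := ⟨S.q, h2⟩
  have hle : Nat.find hex ≤ S.q := Nat.find_min' hex h2
  refine ⟨Nat.find hex, hle, ?_, Nat.find_spec hex⟩
  rcases hp : Nat.find hex with _ | p
  · rw [rightCount_zero]; omega
  · have h4 : S.leftCount p < i := not_le.1 (Nat.find_min hex (by omega))
    have := S.rightCount_succ_add (p := p) (by omega)
    omega

theorem sum_basis_eq {p : ℕ} (hp : p ≤ S.q) (c : ℕ → ℝ) {y : ℝ} (hy : y ∈ S.piece p) :
    ∑ i ∈ Finset.Icc 1 S.K, c i * S.basis i y =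
      ∑ i ∈ Finset.Ioc (S.rightCount p) (S.leftCount p), c i * S.N S.m i y := by
  have := S.leftCount_le_K hp
  refine (Finset.sum_subset (fun i hi => ?_) fun i _ hi => ?_).symm
  · rw [Finset.mem_Ioc] at hi
    rw [Finset.mem_Icc]
    omega
  · rw [basis, N_eq_zero hp hy, mul_zero]
    rintro ⟨h1, h2⟩
    exact hi (Finset.mem_Ioc.2 ⟨by omega, h2⟩)

theorem coeff_eq_of_sum_basis_eq {p : ℕ} (hp : p ≤ S.q) {c c' : ℕ → ℝ}
    (h : ∀ y ∈ Set.Ioo (S.x p) (S.x (p + 1)), ∑ i ∈ Finset.Icc 1 S.K, c i * S.basis i y =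
      ∑ i ∈ Finset.Icc 1 S.K, c' i * S.basis i y) {i : ℕ}
    (hi : i ∈ Finset.Ioc (S.rightCount p) (S.leftCount p)) : c i = c' i := by
  refine sub_eq_zero.1 (coeff_eq_of_sum_eq_const hp S.m (S.rightCount p)
    (fun n hn => posAt_of_lt hn) rfl (Nat.le_add_right _ _) (fun i => c i - c' i) 0
    (fun y hy => ?_) i hi)
  have hy' := Ioo_subset_piece p hy
  have := h y hy
  rw [sum_basis_eq hp c hy', sum_basis_eq hp c' hy', ← sub_eq_zero,
    ← Finset.sum_sub_distrib] at this
  simpa only [sub_mul] using this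

theorem lower_K (hj : 1 ≤ j) (hjq : j ≤ S.q) (hk : 1 ≤ S.k j) : (S.lower j).K = S.K + 1 :=
  lower_leftCount_of_ge hj hjq hk hjq

theorem space_subset_lower_space (S : MDSpline) (j : ℕ) : S.space ⊆ (S.lower j).space := by
  rintro f ⟨p, h1, h2, h3⟩
  refine ⟨p, h1, h2, fun i hi r hr => h3 i hi r (hr.trans ?_)⟩
  by_cases h : i = j
  · rw [h, lower_k_self]
    exact Nat.sub_le _ _
  · rw [lower_k_of_ne h]

theorem exists_isLevelRKI_top (hj : 1 ≤ j) (hjq : j ≤ S.q) (hk : 1 ≤ S.k j) :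
    ∃ α, S.IsLevelRKI j S.m α :=
  (exists_isLevelRKI hj hjq hk S.m fun _ hn => posAt_of_lt (S := S.lower j) hn).2

theorem IsLevelRKI.isRKI {α : ℕ → ℝ} (h : S.IsLevelRKI j S.m α) : S.IsRKI j α :=
  fun i _ y _ => h.N_eq (fun _ hn => posAt_of_lt hn)
    (fun _ hn => posAt_of_lt (S := S.lower j) hn) i y

theorem IsRKI.coeff_unique (hj : 1 ≤ j) (hjq : j ≤ S.q) (hk : 1 ≤ S.k j) {α β : ℕ → ℝ}
    (hα : S.IsRKI j α) (hβ : S.IsRKI j β) {i : ℕ} (hi : i ∈ Finset.Icc 1 S.K) :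
    α i = β i ∧ α (i + 1) = β (i + 1) := by
  have hK := lower_K hj hjq hk
  rw [Finset.mem_Icc] at hi
  -- These are the coefficients of the difference of the two representations of the same N_i;
  -- independence in the lowered space makes them vanish.
  set c : ℕ → ℝ := fun r => if r = i then α i - β i else if r = i + 1 then
    β (i + 1) - α (i + 1) else 0 with hc
  have hci : c i = α i - β i := if_pos rfl
  have hci' : c (i + 1) = β (i + 1) - α (i + 1) := by simp [hc]
  have hsum : ∀ y ∈ Set.Icc S.a S.b,
      ∑ r ∈ Finset.Icc 1 (S.lower j).K, c r * (S.lower j).basis r y = 0 := by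
    intro y hy
    rw [Finset.sum_eq_add_of_mem i (i + 1) (Finset.mem_Icc.2 (by omega))
      (Finset.mem_Icc.2 (by omega)) (by omega), hci, hci']
    · have h1 := hα i (Finset.mem_Icc.2 hi) y hy
      rw [hβ i (Finset.mem_Icc.2 hi) y hy] at h1
      linarith
    · intro r _ hr
      simp only [hc, if_neg hr.1, if_neg hr.2, zero_mul]
  have hzero : ∀ r ∈ Finset.Icc 1 (S.lower j).K, c r = 0 := by
    intro r hr
    obtain ⟨p, hp, hA⟩ := exists_active hr
    refine coeff_eq_of_sum_basis_eq (c' := fun _ => 0) hp (fun y hy => ?_)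
      (Finset.mem_Ioc.2 ⟨by have := hA.1; omega, hA.2⟩)
    rw [hsum y (piece_subset hp (Ioo_subset_piece p hy))]
    simp
  have h1 := hzero i (Finset.mem_Icc.2 (by omega))
  have h2 := hzero (i + 1) (Finset.mem_Icc.2 (by omega))
  rw [hci] at h1
  rw [hci'] at h2
  exact ⟨sub_eq_zero.1 h1, (sub_eq_zero.1 h2).symm⟩

/-- The two extra terms on the left involve ξ at the meaningless indices 0 and K + 1; they drop out
once α_1 = 1 and α_{K+1} = 0. -/
theorem sum_knot_insertion (ξ α g : ℕ → ℝ) (K : ℕ) :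
    ∑ i ∈ Finset.Icc 1 K, ξ i * (α i * g i + (1 - α (i + 1)) * g (i + 1)) +
        ξ (K + 1) * α (K + 1) * g (K + 1) + ξ 0 * (1 - α 1) * g 1 =
      ∑ i ∈ Finset.Icc 1 (K + 1), (ξ i * α i + ξ (i - 1) * (1 - α i)) * g i := by
  induction K with
  | zero => simp; ring
  | succ K ih =>
    rw [Finset.sum_Icc_succ_top (by omega), Finset.sum_Icc_succ_top (b := K + 1) (by omega), ← ih,
      Nat.add_sub_cancel]
    ring

theorem greville_lower (hj : 1 ≤ j) (hjq : j ≤ S.q) (hk : 1 ≤ S.k j) {α ξ ξh : ℕ → ℝ}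
    (hα : S.IsRKI j α) (h1 : α 1 = 1) (hK1 : α (S.K + 1) = 0) (hξ : S.IsGreville ξ)
    (hξh : (S.lower j).IsGreville ξh) {p : ℕ} (hp : p ≤ S.q) (hd : 1 ≤ S.d p) {i : ℕ}
    (hi : i ∈ Finset.Ioc ((S.lower j).rightCount p) ((S.lower j).leftCount p)) :
    ξh i = ξ i * α i + ξ (i - 1) * (1 - α i) := by
  refine coeff_eq_of_sum_basis_eq (S := S.lower j)
    (c' := fun i => ξ i * α i + ξ (i - 1) * (1 - α i)) hp (fun y hy => ?_) hi
  have hy' : y ∈ Set.Icc (S.x p) (S.x (p + 1)) := Set.Ioo_subset_Icc_self hy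
  have hab : y ∈ Set.Icc S.a S.b := piece_subset hp (Ioo_subset_piece p hy)
  rw [hξh p hp hd y hy', lower_K hj hjq hk,
    ← sum_knot_insertion ξ α (fun i => (S.lower j).basis i y), h1, hK1]
  have hy1 := hξ p hp hd y hy'
  rw [Finset.sum_congr rfl fun i hi => by rw [hα i hi y hab]] at hy1
  linarith

/-- Differentiating ∑ ξ_i N_i = x writes the constant 1 through level m - 1, so every coefficient
(ξ_i - ξ_{i-1}) δ_{i,m-1} active on the piece equals 1. -/
theorem greville_sub_ne_zero {ξ : ℕ → ℝ} (hξ : S.IsGreville ξ) {p : ℕ} (hp : p ≤ S.q)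
    (hd : 1 ≤ S.d p) {i : ℕ}
    (hi : i ∈ Finset.Ioc (S.rightCount p + 1) (S.leftCount p)) : ξ i - ξ (i - 1) ≠ 0 := by
  have hdm := S.d_le_m hp
  obtain ⟨n, hn⟩ : ∃ n, S.m = n + 1 := ⟨S.m - 1, by omega⟩
  have hpos : ∀ n' < n + 1, S.PosAt n' := fun n' hn' => posAt_of_lt (by omega)
  have h := coeff_eq_of_sum_eq_const hp n (S.rightCount p + 1)
    (fun n' hn' => hpos n' (by omega)) (by omega) (by omega)
    (fun i => (ξ i - ξ (i - 1)) * S.weight n i) 1 (fun y hy => by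
      have h1 := hasDerivAt_sum_N (b := S.rightCount p) hpos hp (by omega) (by omega) ξ hy
      have h2 : HasDerivAt (fun y : ℝ => y) 1 y := hasDerivAt_id y
      have h3 := h1.unique (h2.congr_of_eventuallyEq (by
        filter_upwards [Ioo_mem_nhds hy.1 hy.2] with z hz
        rw [← hn, ← sum_basis_eq hp ξ (Ioo_subset_piece p hz)]
        exact hξ p hp hd z (Set.Ioo_subset_Icc_self hz)))
      simpa only [mul_assoc] using h3) i hi
  exact left_ne_zero_of_mul_eq_one h

end

end MDSpline

end

/-! ### Location of the coefficients and the Greville formula -/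

theorem mainTheorem2 (S : MDSpline) (j : ℕ) (hj : j ∈ Finset.Icc 1 S.q) (hk : 1 ≤ S.k j)
    (l : ℕ) (hl : l ∈ Finset.Icc 1 S.K) (hsl : S.s l ≤ S.x j)
    (hls : S.x j < min (S.s (l + 1)) S.b) :
    S.space ⊆ (S.lower j).space ∧
    (∃ α : ℕ → ℝ, S.IsRKI j α) ∧
    ∀ α : ℕ → ℝ, S.IsRKI j α →
      (∀ i ∈ Finset.Icc 1 (l - S.d j), α i = 1) ∧
      (∀ i ∈ Finset.Icc (l - S.d j + 1) (l - S.d j + S.k j), α i ∈ Set.Ioo (0 : ℝ) 1) ∧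
      (∀ i ∈ Finset.Icc (l - S.d j + S.k j + 1) (S.K + 1), α i = 0) ∧
      ∀ ξ ξh : ℕ → ℝ, S.IsGreville ξ → (S.lower j).IsGreville ξh →
        ∀ i ∈ Finset.Icc (l - S.d j + 1) (l - S.d j + S.k j),
          ξ i - ξ (i - 1) ≠ 0 ∧ α i = (ξh i - ξ (i - 1)) / (ξ i - ξ (i - 1)) := by
  obtain ⟨hj1, hjq⟩ := Finset.mem_Icc.1 hj
  have hA := S.leftCount_eq hjq
  have hT := MDSpline.leftCount_pred hj1 hjq
  have hAK := S.leftCount_le_K hjq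
  have hl1 : l ≤ S.leftCount j := (S.s_le_iff hjq).1 hsl
  have hl2 : S.leftCount j < l + 1 := by
    by_contra! hc
    exact absurd ((S.s_le_iff hjq).2 hc) (not_le.2 (hls.trans_le (min_le_left _ _)))
  -- The conditions on l say that it equals `leftCount j`, so the subtraction is not truncated.
  have hld : l - S.d j = S.rightCount j + 1 := by omega
  have hkd := S.k_le j hj
  have hkd' : S.k j ≤ S.d j := hkd.trans (min_le_right _ _)
  obtain ⟨γ, hγ⟩ := MDSpline.exists_isLevelRKI_top hj1 hjq hk
  refine ⟨S.space_subset_lower_space j, ⟨γ, hγ.isRKI⟩, fun α hα => ?_⟩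
  have hαγ : ∀ i ∈ Finset.Icc 1 (S.K + 1), α i = γ i := by
    intro i hi
    rw [Finset.mem_Icc] at hi
    by_cases hiK : i ≤ S.K
    · exact (hα.coeff_unique hj1 hjq hk hγ.isRKI (Finset.mem_Icc.2 ⟨hi.1, hiK⟩)).1
    -- The last coefficient α_{K+1} occurs only in the relation for N_K.
    · have := (hα.coeff_unique hj1 hjq hk hγ.isRKI
        (Finset.mem_Icc.2 ⟨by omega, le_refl S.K⟩)).2
      rwa [show i = S.K + 1 by omega]
  rw [hld]
  have hone : ∀ i ∈ Finset.Icc 1 (S.rightCount j + 1), α i = 1 := by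
    intro i hi
    rw [Finset.mem_Icc] at hi
    rw [hαγ i (Finset.mem_Icc.2 (by omega))]
    exact hγ.1 i (by omega) (by omega)
  have hzero : ∀ i ∈ Finset.Icc (S.rightCount j + 1 + S.k j + 1) (S.K + 1), α i = 0 := by
    intro i hi
    rw [Finset.mem_Icc] at hi
    rw [hαγ i (Finset.mem_Icc.2 (by omega))]
    exact hγ.2.2.1 i (by omega)
  refine ⟨hone, fun i hi => ?_, hzero, fun ξ ξh hξ hξh i hi => ?_⟩
  · rw [Finset.mem_Icc] at hi
    rw [hαγ i (Finset.mem_Icc.2 (by omega))]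
    exact hγ.2.1 i (by omega) (by omega)
  · rw [Finset.mem_Icc] at hi
    -- Piece j serves here: d_j ≥ k_j ≥ 1, and k_j ≤ d_j keeps the whole index range inside its
    -- window.
    have hne := MDSpline.greville_sub_ne_zero hξ hjq (hk.trans hkd')
      (Finset.mem_Ioc.2 (show S.rightCount j + 1 < i ∧ i ≤ S.leftCount j by omega))
    refine ⟨hne, ?_⟩
    have hlow := MDSpline.greville_lower hj1 hjq hk hα
      (hone 1 (Finset.mem_Icc.2 (by omega))) (hzero (S.K + 1) (Finset.mem_Icc.2 (by omega)))
      hξ hξh hjq (hk.trans hkd') (i := i) (by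
        rw [MDSpline.lower_leftCount_of_ge hj1 hjq hk le_rfl,
          MDSpline.lower_rightCount_of_ge hj1 hjq hk le_rfl, Finset.mem_Ioc]
        omega)
    rw [eq_div_iff hne, hlow]
    ring
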